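/- Let $P$ be a locally finite poset (for instance a finite one) with least element $\hat 0$ and set of atoms $S$, and let $\Bbbk$ be a field. All homology is reduced simplicial homology with coefficients in $\Bbbk$; complexes contain the empty face, so $\widetilde H_{-1}$ of the empty complex is $\Bbbk$. A crosscut of a poset $Q$ is an antichain $C\subseteq Q$ such that every finite nonempty chain of $Q$ has an element of $C$ comparable to all its members, and every nonempty $A\subseteq C$ that is bounded above or below in $Q$ has a join or a meet in $Q$. For $\alpha\in P$ let $D_\alpha$ be the order complex of $(\hat 0,\alpha]$, $\Delta_\alpha$ the order complex of $(\hat 0,\alpha)$, $\Sigma_\alpha$ the full simplex on the atoms below $\alpha$, and $\Gamma_\alpha=\bigcup_{\lambda\lessdot\alpha}\Sigma_\lambda$ (always including the empty face). Assume that $S$ is a crosscut of $P\smallsetminus\{\hat 0\}$, and let $\Gamma(P,S)$ be the crosscut complex, whose faces are the finite subsets of $S$ bounded in $P\smallsetminus\{\hat 0\}$, together with $\emptyset$. Fix a total order on $S$. Björner's map $f$ from the order complex of $P\smallsetminus\{\hat 0\}$ to $\Gamma(P,S)$ is given on chains by $f_\sharp=\mathrm{unsd}_\sharp\circ h_\sharp\circ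 \mathrm{sd}_\sharp$, where $\mathrm{sd}_\sharp$ is barycentric subdivision, $h$ is the simplicial map of barycentric subdivisions induced by $\sigma\mapsto\{x\in S: x\le a\text{ for all }a\in\sigma\}$ (for nonempty chains $\sigma$), and $\mathrm{unsd}$ sends a nonempty face of $\Gamma(P,S)$, as a vertex of the subdivision, to its least atom. For $\lambda\lessdot\alpha$ and $n\ge 0$ let $\varphi^{\alpha,\lambda}_{n+2}:\widetilde H_n(\Delta_\alpha)\to\widetilde H_{n-1}(\Delta_\lambda)$ be the Mayer–Vietoris connecting map $[c'+c'']\mapsto[\partial c']$ of $\Delta_\alpha=D_\lambda\cup\bigcup_{\lambda\ne\beta\lessdot\alpha}D_\beta$ (with $c'$ supported on $D_\lambda$ and $c''$ on the other part), followed by the map induced by the inclusion of the intersection of the two parts into $\Delta_\lambda$. Define $\varphi^{\alpha,\lambda}_{n+2}:\widetilde H_n(\Gamma_\alpha)\to\widetilde H_{n-1}(\Gamma_\lambda)$ in the same way from $\Gamma_\alpha=\Sigma_\lambda\cup\bigcup_{\lambda\ne\beta\lessdot\alpha}\Sigma_\beta$. Let $C_0(P)=\widetilde H_{-1}(\emptyset)$,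 $C_i(P)=\bigoplus_{\alpha\ne\hat 0}\widetilde H_{i-2}(\Delta_\alpha)$ for $i\ge 1$; let $\varphi_i:C_i(P)\to C_{i-1}(P)$ be, on the $\alpha$ component, $\sum_{\hat 0\ne\lambda\lessdot\alpha}\varphi_i^{\alpha,\lambda}$ for $i\ge 2$, and for $i=1$ the identity of $\widetilde H_{-1}(\emptyset)$ if $\alpha\in S$ and $0$ otherwise. Let $C_\bullet(P,\Gamma)$ be the analogous sequence with $\Gamma_\alpha$ in place of $\Delta_\alpha$. Then $f_\sharp$ maps the chains of $\Delta_\alpha$ to those of $\Gamma_\alpha$ for every $\alpha$, and the induced maps $\mathfrak f$ on reduced homology satisfy the following. 1. For every $\beta\lessdot\alpha$ in $P$ and every $i\ge 1$, the maps $\mathfrak f_i:\widetilde H_i(\Delta_\alpha)\to\widetilde H_i(\Gamma_\alpha)$ and $\mathfrak f_{i-1}:\widetilde H_{i-1}(\Delta_\beta)\to\widetilde H_{i-1}(\Gamma_\beta)$ are isomorphisms, and $\mathfrak f_{i-1}\circ\varphi_{i+2}^{\alpha,\beta}=\varphi_{i+2}^{\alpha,\beta}\circ\mathfrak f_i$.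 2. The maps induced by $f$ are isomorphisms $C_i(P)\to C_i(P,\Gamma)$ for all $i\ge 0$, and they commute with $\varphi_i$ for all $i\ge 1$. -/

import Mathlib

set_option linter.unusedSectionVars false

noncomputable section

open scoped DirectSum

/-- An abstract simplicial complex on the vertex type `V`, with the empty face included (as is
needed for reduced homology). The vertices are partially ordered and each face is totally ordered;
the order orients the faces: `{v₀ < ⋯ < vₖ}` stands for the oriented simplex `[v₀, …, vₖ]`. For a
linearly ordered vertex type this is any simplicial complex. -/
structure OrdComplex (V : Type*) [PartialOrder V] where
  faces : Set (Finset V)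
  isChain : ∀ s ∈ faces, IsChain (· ≤ ·) (s : Set V)
  empty_mem : ∅ ∈ faces
  down_closed : ∀ s ∈ faces, ∀ t, t ⊆ s → t ∈ faces

namespace OrdComplex

variable {V W : Type*} [PartialOrder V] [PartialOrder W]

/-- The intersection of two complexes. -/
def inter (K L : OrdComplex V) : OrdComplex V where
  faces := K.faces ∩ L.faces
  isChain s hs := K.isChain s hs.1
  empty_mem := ⟨K.empty_mem, L.empty_mem⟩
  down_closed s hs t ht := ⟨K.down_closed s hs.1 t ht, L.down_closed s hs.2 t ht⟩

/-- The union of the complexes `F i`, `i ∈ I` (for empty `I` it is the empty complex `{∅}`). -/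
def union {ι : Type*} (I : Set ι) (F : ι → OrdComplex V) : OrdComplex V where
  faces := {s | s = ∅ ∨ ∃ i ∈ I, s ∈ (F i).faces}
  isChain s hs := by
    rcases hs with rfl | ⟨i, -, hs⟩
    · simp
    · exact (F i).isChain s hs
  empty_mem := Or.inl rfl
  down_closed s hs t ht := by
    rcases hs with rfl | ⟨i, hi, hs⟩
    · exact Or.inl (Finset.subset_empty.mp ht)
    · exact Or.inr ⟨i, hi, (F i).down_closed s hs t ht⟩

/-- The empty complex, whose only face is `∅`. -/
def emptyComplex (V : Type*) [PartialOrder V] : OrdComplex V where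
  faces := {∅}
  isChain s hs := by rw [Set.mem_singleton_iff.mp hs]; simp
  empty_mem := rfl
  down_closed s hs t ht := by
    rw [Set.mem_singleton_iff.mp hs] at ht
    exact Finset.subset_empty.mp ht

/-- The order complex of a subset `A` of a poset: the finite chains of elements of `A`. -/
def orderComplex (A : Set V) : OrdComplex V where
  faces := {s | (s : Set V) ⊆ A ∧ IsChain (· ≤ ·) (s : Set V)}
  isChain s hs := hs.2
  empty_mem := by simp
  down_closed s hs t ht :=
    ⟨(Finset.coe_subset.mpr ht).trans hs.1, hs.2.mono (Finset.coe_subset.mpr ht)⟩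

open Classical in
/-- The sign `(-1) ^ j` for the `j`-th vertex `v = vⱼ` of the face `s = {v₀ < ⋯ < vₖ}`. -/
def sgn (𝕜 : Type*) [CommRing 𝕜] (s : Finset V) (v : V) : 𝕜 :=
  (-1) ^ (s.filter (fun w => w < v)).card

open Classical in
/-- The simplicial boundary map,
`∂ [v₀, …, vₖ] = ∑ j, (-1) ^ j [v₀, …, v̂ⱼ, …, vₖ]`; in particular `∂ [v] = ∅` (augmentation). -/
def boundary (𝕜 : Type*) [CommRing 𝕜] (V : Type*) [PartialOrder V] :
    (Finset V →₀ 𝕜) →ₗ[𝕜] (Finset V →₀ 𝕜) :=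
  Finsupp.linearCombination 𝕜 fun s => ∑ v ∈ s, Finsupp.single (s.erase v) (sgn 𝕜 s v)

variable (𝕜 : Type*) [CommRing 𝕜]

/-- The reduced chain module `C̃_{n-1}(K; 𝕜)`: combinations of the faces with `n` vertices,
that is, of dimension `n - 1`. -/
def chains (K : OrdComplex V) (n : ℕ) : Submodule 𝕜 (Finset V →₀ 𝕜) :=
  Finsupp.supported 𝕜 𝕜 {s | s ∈ K.faces ∧ s.card = n}

theorem single_mem_chains {K : OrdComplex V} {n : ℕ} {s : Finset V} (hs : s ∈ K.faces)
    (hn : s.card = n) (a : 𝕜) : Finsupp.single s a ∈ K.chains 𝕜 n :=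
  Finsupp.single_mem_supported 𝕜 a ⟨hs, hn⟩

theorem chains_mono {K L : OrdComplex V} (h : K.faces ⊆ L.faces) (n : ℕ) :
    K.chains 𝕜 n ≤ L.chains 𝕜 n :=
  Finsupp.supported_mono fun _ hs => ⟨h hs.1, hs.2⟩

/- To check a property of all chains it suffices to check faces. -/
theorem chains_le {K : OrdComplex V} {n : ℕ} {p : Submodule 𝕜 (Finset V →₀ 𝕜)}
    (h : ∀ s ∈ K.faces, s.card = n → Finsupp.single s 1 ∈ p) : K.chains 𝕜 n ≤ p := by
  rw [chains, Finsupp.supported_eq_span_single, Submodule.span_le]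
  rintro _ ⟨s, hs, rfl⟩
  exact h s hs.1 hs.2

open Classical in
theorem boundary_single (s : Finset V) :
    boundary 𝕜 V (Finsupp.single s 1) =
      ∑ v ∈ s, Finsupp.single (s.erase v) (sgn 𝕜 s v) := by
  simp [boundary]

theorem boundary_mem {K : OrdComplex V} {n : ℕ} {c : Finset V →₀ 𝕜}
    (hc : c ∈ K.chains 𝕜 (n + 1)) : boundary 𝕜 V c ∈ K.chains 𝕜 n := by
  classical
  suffices K.chains 𝕜 (n + 1) ≤ (K.chains 𝕜 n).comap (boundary 𝕜 V) from this hc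
  refine chains_le 𝕜 fun s hs hn => ?_
  rw [Submodule.mem_comap, boundary_single]
  refine Submodule.sum_mem _ fun v hv => single_mem_chains 𝕜
    (K.down_closed s hs _ (Finset.erase_subset _ _)) ?_ _
  convert Finset.card_erase_of_mem hv using 1
  omega

open Classical in
theorem sgn_erase_of_lt {s : Finset V} {u v : V} (hu : u ∈ s) (huv : u < v) :
    sgn 𝕜 (s.erase u) v = - sgn 𝕜 s v := by
  unfold sgn
  have h : (s.erase u).filter (fun w => w < v) = (s.filter (fun w => w < v)).erase u := by
    ext w; simp; tauto
  have h2 : u ∈ s.filter (fun w => w < v) := by simp [hu, huv]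
  rw [h, ← Finset.card_erase_add_one h2, pow_succ]; ring

open Classical in
theorem sgn_erase_of_not_lt {s : Finset V} {u v : V} (huv : ¬ u < v) :
    sgn 𝕜 (s.erase u) v = sgn 𝕜 s v := by
  unfold sgn
  congr 2
  ext w; simp only [Finset.mem_filter, Finset.mem_erase]
  constructor
  · tauto
  · rintro ⟨h1, h2⟩
    exact ⟨⟨by rintro rfl; exact huv h2, h1⟩, h2⟩

theorem lt_or_lt_of_chain {s : Finset V} (hs : IsChain (· ≤ ·) (s : Set V)) {u v : V}
    (hu : u ∈ s) (hv : v ∈ s) (huv : u ≠ v) : u < v ∧ ¬ v < u ∨ v < u ∧ ¬ u < v := by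
  rcases hs hu hv huv with h | h
  · exact Or.inl ⟨lt_of_le_of_ne h huv, not_lt_of_ge h⟩
  · exact Or.inr ⟨lt_of_le_of_ne h huv.symm, not_lt_of_ge h⟩

open Classical in
theorem sgn_swap {s : Finset V} (hs : IsChain (· ≤ ·) (s : Set V)) {u v : V}
    (hu : u ∈ s) (hv : v ∈ s) (huv : u ≠ v) :
    sgn 𝕜 s u * sgn 𝕜 (s.erase u) v = - (sgn 𝕜 s v * sgn 𝕜 (s.erase v) u) := by
  rcases lt_or_lt_of_chain hs hu hv huv with ⟨h1, h2⟩ | ⟨h1, h2⟩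
  · rw [sgn_erase_of_lt 𝕜 hu h1, sgn_erase_of_not_lt 𝕜 h2]; ring
  · rw [sgn_erase_of_lt 𝕜 hv h1, sgn_erase_of_not_lt 𝕜 h2]; ring

theorem single_smul_one (s : Finset V) (a : 𝕜) :
    Finsupp.single s a = a • Finsupp.single s (1 : 𝕜) := by simp

theorem boundary_boundary_single {s : Finset V} (hs : IsChain (· ≤ ·) (s : Set V)) :
    boundary 𝕜 V (boundary 𝕜 V (Finsupp.single s 1)) = 0 := by
  classical
  rw [boundary_single, map_sum]
  have h : ∀ v ∈ s, boundary 𝕜 V (Finsupp.single (s.erase v) (sgn 𝕜 s v)) =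
      ∑ w ∈ s.erase v, Finsupp.single ((s.erase v).erase w)
        (sgn 𝕜 s v * sgn 𝕜 (s.erase v) w) := by
    intro v hv
    rw [single_smul_one, map_smul]
    erw [boundary_single]
    rw [Finset.smul_sum]
    refine Finset.sum_congr ?_ fun w hw => ?_
    · congr
    · rw [Finsupp.smul_single, smul_eq_mul]; 
  rw [Finset.sum_congr rfl h, Finset.sum_sigma']
  refine Finset.sum_involution (fun p _ => ⟨p.2, p.1⟩) ?_ ?_ ?_ ?_
  · rintro ⟨v, w⟩ hp
    simp only [Finset.mem_sigma, Finset.mem_erase] at hp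
    rw [sgn_swap 𝕜 hs hp.1 hp.2.2 (Ne.symm hp.2.1), Finset.erase_right_comm, ← Finsupp.single_add]
    simp
  · rintro ⟨v, w⟩ hp _
    simp only [Finset.mem_sigma, Finset.mem_erase] at hp
    intro h
    simp only [Sigma.mk.injEq] at h
    exact hp.2.1 h.1
  · rintro ⟨v, w⟩ hp
    simp only [Finset.mem_sigma, Finset.mem_erase] at hp ⊢
    exact ⟨hp.2.2, Ne.symm hp.2.1, hp.1⟩
  · rintro ⟨v, w⟩ hp
    rfl

theorem boundary_boundary {K : OrdComplex V} {n : ℕ} {c : Finset V →₀ 𝕜}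
    (hc : c ∈ K.chains 𝕜 n) : boundary 𝕜 V (boundary 𝕜 V c) = 0 := by
  suffices K.chains 𝕜 n ≤ LinearMap.ker (boundary 𝕜 V ∘ₗ boundary 𝕜 V) from this hc
  exact chains_le 𝕜 fun s hs _ => boundary_boundary_single 𝕜 (K.isChain s hs)


/-- The reduced cycles of dimension `n - 1`. -/
def cycles (K : OrdComplex V) (n : ℕ) : Submodule 𝕜 (Finset V →₀ 𝕜) :=
  K.chains 𝕜 n ⊓ LinearMap.ker (boundary 𝕜 V)

instance (p : Submodule 𝕜 (Finset V →₀ 𝕜)) : AddCommGroup p := Submodule.addCommGroup p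

/-- The boundaries of dimension `n - 1`. -/
def boundaries (K : OrdComplex V) (n : ℕ) : Submodule 𝕜 (Finset V →₀ 𝕜) :=
  (K.chains 𝕜 (n + 1)).map (boundary 𝕜 V)

/-- The reduced homology `H̃_{n-1}(K; 𝕜)`. The index `n` is the number of vertices of a
simplex, so that `Homology 𝕜 K 0` is `H̃_{-1}` and `Homology 𝕜 K (i + 1)` is `H̃_i`. -/
abbrev Homology (K : OrdComplex V) (n : ℕ) : Type _ :=
  K.cycles 𝕜 n ⧸ (K.boundaries 𝕜 n).submoduleOf (K.cycles 𝕜 n)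

/-- `F` restricts to a chain map from the reduced chain complex of `K` to that of `L`. -/
structure IsChainMap (K : OrdComplex V) (L : OrdComplex W)
    (F : (Finset V →₀ 𝕜) →ₗ[𝕜] (Finset W →₀ 𝕜)) : Prop where
  map_mem : ∀ n, ∀ c ∈ K.chains 𝕜 n, F c ∈ L.chains 𝕜 n
  comm : ∀ n, ∀ c ∈ K.chains 𝕜 n, boundary 𝕜 W (F c) = F (boundary 𝕜 V c)

variable {𝕜}

theorem IsChainMap.of_faces {K : OrdComplex V} {L : OrdComplex W}
    {F : (Finset V →₀ 𝕜) →ₗ[𝕜] (Finset W →₀ 𝕜)}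
    (h : ∀ s ∈ K.faces, F (Finsupp.single s 1) ∈ L.chains 𝕜 s.card ∧
      boundary 𝕜 W (F (Finsupp.single s 1)) = F (boundary 𝕜 V (Finsupp.single s 1))) :
    IsChainMap 𝕜 K L F where
  map_mem n c hc := by
    suffices K.chains 𝕜 n ≤ (L.chains 𝕜 n).comap F from this hc
    rintro c hc
    refine chains_le 𝕜 (fun s hs hn => ?_) hc
    subst hn
    exact (h s hs).1
  comm n c hc := by
    suffices K.chains 𝕜 n ≤ LinearMap.eqLocus (boundary 𝕜 W ∘ₗ F) (F ∘ₗ boundary 𝕜 V) from this hc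
    exact chains_le 𝕜 fun s hs _ => (h s hs).2

theorem IsChainMap.comp {X : Type*} [PartialOrder X] {K : OrdComplex V} {L : OrdComplex W}
    {M : OrdComplex X} {G : (Finset W →₀ 𝕜) →ₗ[𝕜] (Finset X →₀ 𝕜)}
    {F : (Finset V →₀ 𝕜) →ₗ[𝕜] (Finset W →₀ 𝕜)}
    (hG : IsChainMap 𝕜 L M G) (hF : IsChainMap 𝕜 K L F) : IsChainMap 𝕜 K M (G ∘ₗ F) where
  map_mem n c hc := hG.map_mem n _ (hF.map_mem n c hc)
  comm n c hc := by
    simp only [LinearMap.comp_apply]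
    rw [hG.comm n _ (hF.map_mem n c hc), hF.comm n c hc]

theorem IsChainMap.id {K L : OrdComplex V} (h : K.faces ⊆ L.faces) :
    IsChainMap 𝕜 K L LinearMap.id where
  map_mem n _ hc := chains_mono 𝕜 h n hc
  comm _ _ _ := rfl

theorem IsChainMap.map_cycles {K : OrdComplex V} {L : OrdComplex W}
    {F : (Finset V →₀ 𝕜) →ₗ[𝕜] (Finset W →₀ 𝕜)} (hF : IsChainMap 𝕜 K L F) (n : ℕ) :
    ∀ c ∈ K.cycles 𝕜 n, F c ∈ L.cycles 𝕜 n := fun c hc => by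
  refine ⟨hF.map_mem n c hc.1, ?_⟩
  have h : boundary 𝕜 V c = 0 := hc.2
  change boundary 𝕜 W (F c) = 0
  rw [hF.comm n c hc.1, h, map_zero]

/-- The map induced on reduced homology by a chain map. -/
def homologyMap {K : OrdComplex V} {L : OrdComplex W}
    {F : (Finset V →₀ 𝕜) →ₗ[𝕜] (Finset W →₀ 𝕜)} (hF : IsChainMap 𝕜 K L F) (n : ℕ) :
    K.Homology 𝕜 n →ₗ[𝕜] L.Homology 𝕜 n :=
  Submodule.mapQ _ _ (F.restrict (hF.map_cycles n)) <| by
    rintro ⟨c, hc⟩ ⟨e, he, rfl⟩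
    exact ⟨F e, hF.map_mem _ e he, hF.comm _ e he⟩

variable (𝕜) in
/-- The map induced on reduced homology by an inclusion `K ⊆ L`. -/
def inclusionMap {K L : OrdComplex V} (h : K.faces ⊆ L.faces) (n : ℕ) :
    K.Homology 𝕜 n →ₗ[𝕜] L.Homology 𝕜 n :=
  homologyMap (IsChainMap.id h) n

variable (𝕜) in
open Classical in
/-- The part of a chain that is supported on the faces of `A`. -/
def restrictTo (A : OrdComplex V) : (Finset V →₀ 𝕜) →ₗ[𝕜] (Finset V →₀ 𝕜) :=
  Finsupp.linearCombination 𝕜 fun s => if s ∈ A.faces then Finsupp.single s 1 else 0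

theorem restrictTo_mem {A B K : OrdComplex V} (hK : K.faces = A.faces ∪ B.faces) {n : ℕ}
    {c : Finset V →₀ 𝕜} (hc : c ∈ K.chains 𝕜 n) :
    restrictTo 𝕜 A c ∈ A.chains 𝕜 n ∧ c - restrictTo 𝕜 A c ∈ B.chains 𝕜 n := by
  suffices K.chains 𝕜 n ≤ (A.chains 𝕜 n).comap (restrictTo 𝕜 A) ⊓
    (B.chains 𝕜 n).comap (LinearMap.id - restrictTo 𝕜 A) from this hc
  refine chains_le 𝕜 fun s hs hn => ?_
  simp only [Submodule.mem_inf, Submodule.mem_comap, LinearMap.sub_apply, LinearMap.id_apply,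
    restrictTo, Finsupp.linearCombination_single, one_smul]
  split_ifs with h
  · exact ⟨single_mem_chains 𝕜 h hn _, by simp⟩
  · rw [hK] at hs
    exact ⟨Submodule.zero_mem _, by
      rw [sub_zero]; exact single_mem_chains 𝕜 (hs.resolve_left h) hn _⟩

theorem mem_chains_inter {A B : OrdComplex V} {n : ℕ} {c : Finset V →₀ 𝕜}
    (ha : c ∈ A.chains 𝕜 n) (hb : c ∈ B.chains 𝕜 n) : c ∈ (A.inter B).chains 𝕜 n := by
  rw [chains, Finsupp.mem_supported] at *
  exact fun s hs => ⟨⟨(ha hs).1, (hb hs).1⟩, (ha hs).2⟩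

theorem boundary_part_mem_cycles {A B : OrdComplex V} {n : ℕ} {a b : Finset V →₀ 𝕜}
    (ha : a ∈ A.chains 𝕜 (n + 1)) (hb : b ∈ B.chains 𝕜 (n + 1))
    (h : boundary 𝕜 V (a + b) = 0) : boundary 𝕜 V a ∈ (A.inter B).cycles 𝕜 n := by
  refine ⟨mem_chains_inter (boundary_mem 𝕜 ha) ?_, boundary_boundary 𝕜 ha⟩
  rw [map_add] at h
  rw [eq_neg_of_add_eq_zero_left h]
  exact Submodule.neg_mem _ (boundary_mem 𝕜 hb)

theorem boundary_part_sub_mem {A B : OrdComplex V} {n : ℕ} {a b a' b' : Finset V →₀ 𝕜}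
    (ha : a ∈ A.chains 𝕜 (n + 1)) (hb : b ∈ B.chains 𝕜 (n + 1))
    (ha' : a' ∈ A.chains 𝕜 (n + 1)) (hb' : b' ∈ B.chains 𝕜 (n + 1)) (h : a + b = a' + b') :
    boundary 𝕜 V a - boundary 𝕜 V a' ∈ (A.inter B).boundaries 𝕜 n := by
  refine ⟨a - a', mem_chains_inter (Submodule.sub_mem _ ha ha') ?_, by rw [map_sub]⟩
  have : a - a' = b' - b := by
    rw [sub_eq_sub_iff_add_eq_add, h, add_comm]
  rw [this]
  exact Submodule.sub_mem _ hb' hb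

/-- The connecting homomorphism `H̃_n(K) → H̃_{n-1}(A ∩ B)` of the reduced Mayer–Vietoris sequence
of `K = A ∪ B`: it sends `[c]` to `[∂ c']`, where `c = c' + c''` with `c'` in `A` and `c''` in `B`.
Here `c'` is the part of `c` on the faces of `A`; see `mayerVietoris_mk` for any other splitting. -/
def mayerVietoris {A B K : OrdComplex V} (hK : K.faces = A.faces ∪ B.faces) (n : ℕ) :
    K.Homology 𝕜 (n + 1) →ₗ[𝕜] (A.inter B).Homology 𝕜 n :=
  Submodule.mapQ _ _
    ((boundary 𝕜 V ∘ₗ restrictTo 𝕜 A).restrict (p := K.cycles 𝕜 (n + 1))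
      (q := (A.inter B).cycles 𝕜 n) fun c hc =>
        boundary_part_mem_cycles (restrictTo_mem hK hc.1).1 (restrictTo_mem hK hc.1).2 (by
          rw [add_sub_cancel]; exact hc.2)) <| by
    rintro ⟨c, hc⟩ ⟨e, he, hec⟩
    have h := boundary_part_sub_mem (restrictTo_mem hK hc.1).1 (restrictTo_mem hK hc.1).2
      (boundary_mem 𝕜 (restrictTo_mem hK he).1) (boundary_mem 𝕜 (restrictTo_mem hK he).2)
      (by rw [← map_add, add_sub_cancel, add_sub_cancel]; exact hec.symm)
    rwa [boundary_boundary 𝕜 (restrictTo_mem hK he).1, sub_zero] at h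

/-- Every splitting `a + b` of a cycle computes the connecting homomorphism. -/
theorem mayerVietoris_mk {A B K : OrdComplex V} (hK : K.faces = A.faces ∪ B.faces) (n : ℕ)
    {a b : Finset V →₀ 𝕜} (ha : a ∈ A.chains 𝕜 (n + 1)) (hb : b ∈ B.chains 𝕜 (n + 1))
    (hc : a + b ∈ K.cycles 𝕜 (n + 1)) :
    mayerVietoris hK n (Submodule.Quotient.mk ⟨a + b, hc⟩) =
      Submodule.Quotient.mk ⟨boundary 𝕜 V a, boundary_part_mem_cycles ha hb hc.2⟩ := by
  refine (Submodule.Quotient.eq _).mpr ?_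
  exact boundary_part_sub_mem (restrictTo_mem hK hc.1).1 (restrictTo_mem hK hc.1).2 ha hb
    (add_sub_cancel _ _)

variable (𝕜)

open Classical in
/-- The sign of the permutation that sorts the images of the vertices of `s` under `g`. -/
def mapSign (g : V → W) (s : Finset V) : 𝕜 :=
  (-1) ^ ((s ×ˢ s).filter fun p => p.1 < p.2 ∧ g p.2 < g p.1).card

open Classical in
/-- The chain map of a vertex map `g`: `[v₀, …, vₖ] ↦ [g v₀, …, g vₖ]`, which is `0` if two of the
images agree and otherwise the sorted image with the sign of the sorting permutation. -/
def push (g : V → W) : (Finset V →₀ 𝕜) →ₗ[𝕜] (Finset W →₀ 𝕜) :=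
  Finsupp.linearCombination 𝕜 fun s =>
    if Set.InjOn g s then Finsupp.single (s.image g) (mapSign 𝕜 g s) else 0

open Classical in
def eps (p : Prop) : 𝕜 := if p then -1 else 1

theorem neg_one_pow_card {ι : Type*} (s : Finset ι) (p : ι → Prop) [DecidablePred p] :
    (-1 : 𝕜) ^ (s.filter p).card = ∏ x ∈ s, eps 𝕜 (p x) := by
  classical
  have h : ∀ x ∈ s, eps 𝕜 (p x) = if p x then -1 else 1 := fun x _ => by
    unfold eps; congr
  rw [Finset.prod_congr rfl h, Finset.prod_ite]
  simp

theorem sgn_eq (s : Finset V) (v : V) : sgn 𝕜 s v = ∏ w ∈ s, eps 𝕜 (w < v) := by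
  classical
  rw [← neg_one_pow_card, sgn]

theorem mapSign_eq (g : V → W) (s : Finset V) :
    mapSign 𝕜 g s = ∏ a ∈ s, ∏ b ∈ s, eps 𝕜 (a < b ∧ g b < g a) := by
  rw [mapSign, neg_one_pow_card, Finset.prod_product]

open Classical in
theorem mapSign_erase (g : V → W) {s : Finset V} {v : V} (hv : v ∈ s) :
    mapSign 𝕜 g s = mapSign 𝕜 g (s.erase v) *
      ∏ b ∈ s.erase v, (eps 𝕜 (v < b ∧ g b < g v) * eps 𝕜 (b < v ∧ g v < g b)) := by
  have h0 : eps 𝕜 (v < v ∧ g v < g v) = 1 := by simp [eps]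
  rw [mapSign_eq, mapSign_eq, ← Finset.mul_prod_erase s _ hv, ← Finset.mul_prod_erase s _ hv, h0,
    one_mul, Finset.prod_mul_distrib]
  have h : ∀ a ∈ s.erase v, ∏ b ∈ s, eps 𝕜 (a < b ∧ g b < g a) =
      eps 𝕜 (a < v ∧ g v < g a) * ∏ b ∈ s.erase v, eps 𝕜 (a < b ∧ g b < g a) :=
    fun a _ => (Finset.mul_prod_erase s _ hv).symm
  rw [Finset.prod_congr rfl h, Finset.prod_mul_distrib]
  ring

open Classical in
theorem mapSign_mul_sgn {g : V → W} {s : Finset V} (hs : IsChain (· ≤ ·) (s : Set V))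
    (hg : IsChain (· ≤ ·) (s.image g : Set W)) (hi : Set.InjOn g s) {v : V} (hv : v ∈ s) :
    mapSign 𝕜 g s * sgn 𝕜 (s.image g) (g v) = sgn 𝕜 s v * mapSign 𝕜 g (s.erase v) := by
  have h1 : sgn 𝕜 (s.image g) (g v) = ∏ b ∈ s.erase v, eps 𝕜 (g b < g v) := by
    rw [sgn_eq, Finset.prod_image (fun a ha b hb h => hi ha hb h), ← Finset.mul_prod_erase s _ hv]
    simp [eps]
  have h2 : sgn 𝕜 s v = ∏ b ∈ s.erase v, eps 𝕜 (b < v) := by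
    rw [sgn_eq, ← Finset.mul_prod_erase s _ hv]
    simp [eps]
  rw [h1, h2, mapSign_erase 𝕜 g hv, mul_assoc, ← Finset.prod_mul_distrib, mul_comm]
  congr 1
  refine Finset.prod_congr rfl fun b hb => ?_
  have hb' := Finset.mem_of_mem_erase hb
  have hne := Finset.ne_of_mem_erase hb
  have hgne : g b ≠ g v := fun h => hne (hi hb' hv h)
  rcases lt_or_lt_of_chain hs hb' hv hne with ⟨h3, h4⟩ | ⟨h3, h4⟩ <;>
  rcases lt_or_lt_of_chain hg (Finset.mem_image_of_mem g hb') (Finset.mem_image_of_mem g hv) hgne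
    with ⟨h5, h6⟩ | ⟨h5, h6⟩ <;> simp [eps, h3, h4, h5, h6]

open Classical in
theorem sgn_mul_mapSign_collide {g : V → W} {s : Finset V} (hs : IsChain (· ≤ ·) (s : Set V))
    (hg : IsChain (· ≤ ·) (s.image g : Set W)) {u v : V} (hu : u ∈ s) (hv : v ∈ s) (huv : u ≠ v)
    (hguv : g u = g v) (hi : Set.InjOn g (s.erase u : Finset V)) :
    sgn 𝕜 s u * mapSign 𝕜 g (s.erase u) + sgn 𝕜 s v * mapSign 𝕜 g (s.erase v) = 0 := by
  have hvu : v ∈ s.erase u := Finset.mem_erase.mpr ⟨huv.symm, hv⟩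
  have huv' : u ∈ s.erase v := Finset.mem_erase.mpr ⟨huv, hu⟩
  have hcomm : (s.erase v).erase u = (s.erase u).erase v := Finset.erase_right_comm
  have h1 : sgn 𝕜 s u = eps 𝕜 (v < u) * ∏ b ∈ (s.erase u).erase v, eps 𝕜 (b < u) := by
    rw [sgn_eq, ← Finset.mul_prod_erase s _ hu, ← Finset.mul_prod_erase _ _ hvu]
    simp [eps]
  have h2 : sgn 𝕜 s v = eps 𝕜 (u < v) * ∏ b ∈ (s.erase u).erase v, eps 𝕜 (b < v) := by
    rw [sgn_eq, ← Finset.mul_prod_erase s _ hv, ← Finset.mul_prod_erase _ _ huv', hcomm]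
    simp [eps]
  have h3 : eps 𝕜 (v < u) = - eps 𝕜 (u < v) := by
    rcases lt_or_lt_of_chain hs hu hv huv with ⟨h3, h4⟩ | ⟨h3, h4⟩ <;> simp [eps, h3, h4]
  have h4 : (∏ b ∈ (s.erase u).erase v, eps 𝕜 (b < u)) *
      ∏ b ∈ (s.erase u).erase v, (eps 𝕜 (v < b ∧ g b < g v) * eps 𝕜 (b < v ∧ g v < g b)) =
      (∏ b ∈ (s.erase u).erase v, eps 𝕜 (b < v)) *
      ∏ b ∈ (s.erase u).erase v, (eps 𝕜 (u < b ∧ g b < g u) * eps 𝕜 (b < u ∧ g u < g b)) := by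
    rw [← Finset.prod_mul_distrib, ← Finset.prod_mul_distrib]
    refine Finset.prod_congr rfl fun b hb => ?_
    simp only [Finset.mem_erase] at hb
    have hgne : g b ≠ g v := fun h => hb.1 (hi (by simp [hb]) (by simp [huv.symm, hv]) h)
    rw [hguv]
    rcases lt_or_lt_of_chain hs hb.2.2 hv hb.1 with ⟨h3, h4⟩ | ⟨h3, h4⟩ <;>
    rcases lt_or_lt_of_chain hs hb.2.2 hu hb.2.1 with ⟨h7, h8⟩ | ⟨h7, h8⟩ <;>
    rcases lt_or_lt_of_chain hg (Finset.mem_image_of_mem g hb.2.2) (Finset.mem_image_of_mem g hv)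
      hgne with ⟨h5, h6⟩ | ⟨h5, h6⟩ <;> simp [eps, h3, h4, h5, h6, h7, h8]
  rw [mapSign_erase 𝕜 g hvu, mapSign_erase 𝕜 g huv', hcomm, h1, h2, h3]
  linear_combination (-eps 𝕜 (u < v) * mapSign 𝕜 g ((s.erase u).erase v)) * h4

open Classical in
theorem push_single (g : V → W) (s : Finset V) (a : 𝕜) :
    push 𝕜 g (Finsupp.single s a) =
      if Set.InjOn g s then Finsupp.single (s.image g) (a * mapSign 𝕜 g s) else 0 := by
  rw [push, Finsupp.linearCombination_single]
  split_ifs <;> simp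

theorem isChainMap_push {K : OrdComplex V} {L : OrdComplex W} (g : V → W)
    (h : ∀ s ∈ K.faces, ∀ t : Finset W, (t : Set W) = g '' s → t ∈ L.faces) :
    IsChainMap 𝕜 K L (push 𝕜 g) := by
  classical
  refine IsChainMap.of_faces fun s hs => ?_
  have hsc := K.isChain s hs
  have hgs : s.image g ∈ L.faces := h s hs _ (Finset.coe_image)
  have hgc := L.isChain _ hgs
  have hR : push 𝕜 g (boundary 𝕜 V (Finsupp.single s 1)) = ∑ v ∈ s,
      if Set.InjOn g (s.erase v : Finset V) then
        Finsupp.single ((s.erase v).image g) (sgn 𝕜 s v * mapSign 𝕜 g (s.erase v)) else 0 := by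
    rw [boundary_single, map_sum]
    refine Finset.sum_congr rfl fun v _ => ?_
    convert push_single 𝕜 g (s.erase v) (sgn 𝕜 s v)
  rw [hR]
  have hL := push_single 𝕜 g s 1
  by_cases hi : Set.InjOn g s
  · rw [if_pos hi, one_mul] at hL
    replace hL : push 𝕜 g (Finsupp.single s 1) = Finsupp.single (s.image g) (mapSign 𝕜 g s) := by
      convert hL
    rw [hL]
    refine ⟨single_mem_chains 𝕜 hgs (Finset.card_image_of_injOn hi) _, ?_⟩
    rw [single_smul_one, map_smul, boundary_single, Finset.smul_sum,
      Finset.sum_image (fun a ha b hb h => hi ha hb h)]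
    refine Finset.sum_congr rfl fun v hv => ?_
    rw [if_pos (hi.mono (by simp)), Finsupp.smul_single, smul_eq_mul]
    congr 1
    · ext w
      simp only [Finset.mem_erase, Finset.mem_image]
      constructor
      · rintro ⟨h1, a, ha, rfl⟩
        exact ⟨a, ⟨by rintro rfl; exact h1 rfl, ha⟩, rfl⟩
      · rintro ⟨a, ⟨h1, ha⟩, rfl⟩
        exact ⟨fun h => h1 (hi ha hv h), a, ha, rfl⟩
    · convert mapSign_mul_sgn 𝕜 hsc (by convert hgc) hi hv
  · rw [if_neg hi] at hL
    rw [hL]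
    refine ⟨Submodule.zero_mem _, ?_⟩
    rw [map_zero]
    simp only [Set.InjOn, Finset.mem_coe, not_forall] at hi
    obtain ⟨u, hu, v, hv, hguv, huv⟩ := hi
    have hz : ∀ x ∈ s, x ≠ u ∧ x ≠ v → (if Set.InjOn g (s.erase x : Finset V) then
        Finsupp.single ((s.erase x).image g) (sgn 𝕜 s x * mapSign 𝕜 g (s.erase x)) else 0) = 0 := by
      intro x _ hx
      rw [if_neg]
      intro hinj
      exact huv (hinj (by simp [hu, hx.1.symm]) (by simp [hv, hx.2.symm]) hguv)
    rw [Finset.sum_eq_add_of_mem u v hu hv huv hz]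
    have himg : (s.erase u).image g = (s.erase v).image g := by
      ext w
      simp only [Finset.mem_erase, Finset.mem_image]
      constructor
      · rintro ⟨a, ⟨_, ha⟩, rfl⟩
        by_cases hav : a = v
        · exact ⟨u, ⟨huv, hu⟩, by rw [hguv, hav]⟩
        · exact ⟨a, ⟨hav, ha⟩, rfl⟩
      · rintro ⟨a, ⟨_, ha⟩, rfl⟩
        by_cases hau : a = u
        · exact ⟨v, ⟨Ne.symm huv, hv⟩, by rw [← hguv, hau]⟩
        · exact ⟨a, ⟨hau, ha⟩, rfl⟩
    have hinj : Set.InjOn g (s.erase u : Finset V) ↔ Set.InjOn g (s.erase v : Finset V) := by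
      rw [← Finset.card_image_iff, ← Finset.card_image_iff, himg, Finset.card_erase_of_mem hu,
        Finset.card_erase_of_mem hv]
    by_cases hiu : Set.InjOn g (s.erase u : Finset V)
    · rw [if_pos hiu, if_pos (hinj.mp hiu), himg, ← Finsupp.single_add]
      have := sgn_mul_mapSign_collide 𝕜 hsc (by convert hgc) hu hv huv hguv (by convert hiu)
      have h0 : sgn 𝕜 s u * mapSign 𝕜 g (s.erase u) + sgn 𝕜 s v * mapSign 𝕜 g (s.erase v) = 0 := by
        convert this
      rw [h0, Finsupp.single_zero]
    · rw [if_neg hiu, if_neg (fun h => hiu (hinj.mpr h)), add_zero]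

open Classical in
/-- The join with a vertex, `[v₀, …, vₖ] ↦ [v, v₀, …, vₖ]`. -/
def cone (v : V) : (Finset V →₀ 𝕜) →ₗ[𝕜] (Finset V →₀ 𝕜) :=
  Finsupp.linearCombination 𝕜 fun s =>
    if v ∈ s then 0 else Finsupp.single (insert v s) (sgn 𝕜 s v)

open Classical in
theorem cone_single {v : V} {s : Finset V} (hv : v ∉ s) (a : 𝕜) :
    cone 𝕜 v (Finsupp.single s a) = Finsupp.single (insert v s) (a * sgn 𝕜 s v) := by
  simp [cone, hv]

theorem cone_spec {K L : OrdComplex V} {v : V} (hv : ∀ s ∈ K.faces, v ∉ s)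
    (h : ∀ s ∈ K.faces, ∀ t : Finset V, (t : Set V) = Set.insert v s → t ∈ L.faces) {n : ℕ}
    {c : Finset V →₀ 𝕜} (hc : c ∈ K.chains 𝕜 n) :
    cone 𝕜 v c ∈ L.chains 𝕜 (n + 1) ∧
      boundary 𝕜 V (cone 𝕜 v c) = c - cone 𝕜 v (boundary 𝕜 V c) := by
  classical
  suffices K.chains 𝕜 n ≤ (L.chains 𝕜 (n + 1)).comap (cone 𝕜 v) ⊓
    LinearMap.eqLocus (boundary 𝕜 V ∘ₗ cone 𝕜 v)
      (LinearMap.id - cone 𝕜 v ∘ₗ boundary 𝕜 V) from this hc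
  refine chains_le 𝕜 fun s hs hn => ?_
  have hvs := hv s hs
  have hL : insert v s ∈ L.faces := h s hs _ (Finset.coe_insert v s)
  have h1 : cone 𝕜 v (Finsupp.single s 1) = Finsupp.single (insert v s) (sgn 𝕜 s v) := by
    have := cone_single 𝕜 hvs 1
    rw [one_mul] at this
    convert this
  refine ⟨?_, ?_⟩
  · change cone 𝕜 v (Finsupp.single s 1) ∈ L.chains 𝕜 (n + 1)
    rw [h1]
    exact single_mem_chains 𝕜 hL (by rw [Finset.card_insert_of_notMem hvs, hn]) _
  · change boundary 𝕜 V (cone 𝕜 v (Finsupp.single s 1)) =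
      Finsupp.single s 1 - cone 𝕜 v (boundary 𝕜 V (Finsupp.single s 1))
    have hchain := L.isChain _ hL
    have hvi : v ∈ insert v s := Finset.mem_insert_self _ _
    have h2 : boundary 𝕜 V (Finsupp.single (insert v s) 1) =
        Finsupp.single s (sgn 𝕜 s v) +
        ∑ w ∈ s, Finsupp.single ((insert v s).erase w) (sgn 𝕜 (insert v s) w) := by
      rw [boundary_single, Finset.sum_insert hvs, Finset.erase_insert hvs]
      congr 2
      have := sgn_erase_of_not_lt 𝕜 (s := insert v s) (lt_irrefl v)
      rw [← this]
      congr 1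
      convert Finset.erase_insert hvs
    have h3 : boundary 𝕜 V (Finsupp.single s 1) =
        ∑ w ∈ s, Finsupp.single (s.erase w) (sgn 𝕜 s w) := by
      rw [boundary_single]
    have h4 : ∀ w ∈ s, cone 𝕜 v (Finsupp.single (s.erase w) (sgn 𝕜 s w)) =
        Finsupp.single ((insert v s).erase w) (sgn 𝕜 s w * sgn 𝕜 (s.erase w) v) := by
      intro w hw
      have hne : v ≠ w := by rintro rfl; exact hvs hw
      have := cone_single 𝕜 (v := v) (s := s.erase w) (fun hh => hvs (Finset.mem_of_mem_erase hh))
        (sgn 𝕜 s w)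
      rw [Finset.erase_insert_of_ne hne]
      convert this
    have hsq : sgn 𝕜 s v * sgn 𝕜 s v = 1 := by
      unfold sgn
      rw [← pow_add, ← two_mul, pow_mul]
      simp
    have hw : ∀ w ∈ s, sgn 𝕜 s v * sgn 𝕜 (insert v s) w =
        - (sgn 𝕜 s w * sgn 𝕜 (s.erase w) v) := by
      intro w hw
      have hne : v ≠ w := by rintro rfl; exact hvs hw
      have hwi : w ∈ insert v s := Finset.mem_insert_of_mem hw
      have e1 : (insert v s).erase v = s := Finset.erase_insert hvs
      rcases lt_or_lt_of_chain hchain hvi hwi hne with ⟨a1, a2⟩ | ⟨a1, a2⟩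
      · have b1 := sgn_erase_of_lt 𝕜 hvi a1
        have b2 := sgn_erase_of_not_lt 𝕜 (s := s) a2
        have b3 : sgn 𝕜 s w = - sgn 𝕜 (insert v s) w := by
          rw [← b1]; congr 1; convert e1.symm
        have b4 : sgn 𝕜 (s.erase w) v = sgn 𝕜 s v := by
          rw [← b2]
        rw [b3, b4]; ring
      · have b1 := sgn_erase_of_not_lt 𝕜 (s := insert v s) a2
        have b2 := sgn_erase_of_lt 𝕜 hw a1
        have b3 : sgn 𝕜 s w = sgn 𝕜 (insert v s) w := by
          rw [← b1]; congr 1; convert e1.symm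
        have b4 : sgn 𝕜 (s.erase w) v = - sgn 𝕜 s v := by
          rw [← b2]
        rw [b3, b4]; ring
    rw [h1, single_smul_one, map_smul, h2, h3, map_sum, Finset.sum_congr rfl h4, smul_add,
      Finsupp.smul_single, smul_eq_mul, hsq, Finset.smul_sum, sub_eq_add_neg, ← Finset.sum_neg_distrib]
    congr 1
    refine Finset.sum_congr rfl fun w hws => ?_
    rw [Finsupp.smul_single, smul_eq_mul, hw w hws, Finsupp.single_neg]

/-- The face poset of a complex: its nonempty faces, ordered by inclusion. -/
abbrev FacePoset (K : OrdComplex V) : Type _ := {s : Finset V // s ∈ K.faces ∧ s.Nonempty}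

/-- For `K ⊆ L`, the barycentric subdivision of `K` as a subcomplex of that of `L`: the order
complex of the face poset. `sd L L` is the barycentric subdivision of `L`. -/
def sd (L K : OrdComplex V) : OrdComplex L.FacePoset :=
  orderComplex {t | t.1 ∈ K.faces}

open Classical in
/-- The subdivision operator on a face with the given number of vertices, by the usual recursion:
`sd ∅ = ∅` and `sd s` is the join of the barycentre of `s` with `sd (∂ s)`. -/
def sdAux (L : OrdComplex V) : ℕ → Finset V → (Finset L.FacePoset →₀ 𝕜)
  | 0, _ => Finsupp.single ∅ 1
  | n + 1, s =>
    if h : s ∈ L.faces ∧ s.Nonempty then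
      cone 𝕜 ⟨s, h⟩ (∑ v ∈ s, sgn 𝕜 s v • sdAux L n (s.erase v))
    else 0

/-- The barycentric subdivision operator on chains. -/
def sdChain (L : OrdComplex V) : (Finset V →₀ 𝕜) →ₗ[𝕜] (Finset L.FacePoset →₀ 𝕜) :=
  Finsupp.linearCombination 𝕜 fun s => sdAux 𝕜 L s.card s

theorem sdChain_empty (L : OrdComplex V) :
    sdChain 𝕜 L (Finsupp.single ∅ 1) = Finsupp.single ∅ 1 := by
  simp [sdChain, sdAux]

theorem sdChain_single {L : OrdComplex V} {s : Finset V} (h : s ∈ L.faces ∧ s.Nonempty) :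
    sdChain 𝕜 L (Finsupp.single s 1) =
      cone 𝕜 ⟨s, h⟩ (sdChain 𝕜 L (boundary 𝕜 V (Finsupp.single s 1))) := by
  classical
  obtain ⟨n, hn⟩ : ∃ n, s.card = n + 1 := Nat.exists_eq_succ_of_ne_zero h.2.card_ne_zero
  rw [boundary_single, map_sum]
  rw [sdChain, Finsupp.linearCombination_single, one_smul, hn, sdAux, dif_pos h]
  congr 1
  refine Finset.sum_congr rfl fun v hv => ?_
  rw [Finsupp.linearCombination_single]
  congr 1
  have : (s.erase v).card = n := by rw [Finset.card_erase_of_mem hv, hn]; rfl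
  rw [← this]

theorem sdChain_boundary_mem {L : OrdComplex V} {s : Finset V} {n : ℕ} (hs : s ∈ L.faces)
    (hn : s.card = n + 1)
    (ih : ∀ t ∈ L.faces, t.card = n → sdChain 𝕜 L (Finsupp.single t 1) ∈
      (orderComplex {r : L.FacePoset | r.1 ⊆ t}).chains 𝕜 n) :
    sdChain 𝕜 L (boundary 𝕜 V (Finsupp.single s 1)) ∈
      (orderComplex {r : L.FacePoset | r.1 ⊂ s}).chains 𝕜 n := by
  classical
  rw [boundary_single, map_sum]
  refine Submodule.sum_mem _ fun v hv => ?_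
  rw [single_smul_one, map_smul]
  refine Submodule.smul_mem _ _ ?_
  refine chains_mono 𝕜 ?_ n (ih _ (L.down_closed s hs _ (Finset.erase_subset _ _)) ?_)
  · rintro F ⟨h1, h2⟩
    refine ⟨fun r hr => ?_, h2⟩
    have := h1 hr
    exact lt_of_le_of_lt this (Finset.erase_ssubset hv)
  · have : (s.erase v).card = n := by rw [Finset.card_erase_of_mem hv, hn]; rfl
    convert this

theorem sd_cone_faces {L : OrdComplex V} {s : Finset V} (h : s ∈ L.faces ∧ s.Nonempty) :
    ∀ F ∈ (orderComplex {r : L.FacePoset | r.1 ⊂ s}).faces,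
      ∀ t : Finset L.FacePoset, (t : Set L.FacePoset) = Set.insert ⟨s, h⟩ F →
        t ∈ (orderComplex {r : L.FacePoset | r.1 ⊆ s}).faces := by
  rintro F ⟨h1, h2⟩ t ht
  refine ⟨?_, ?_⟩
  · rw [ht]
    rintro r (rfl | hr)
    · exact Finset.Subset.refl s
    · exact le_of_lt (show r.1 < s from h1 hr)
  · rw [ht]
    exact h2.insert fun b hb _ => Or.inr (show b.1 ≤ s from le_of_lt (show b.1 < s from h1 hb))

theorem sd_cone_notMem {L : OrdComplex V} {s : Finset V} (h : s ∈ L.faces ∧ s.Nonempty) :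
    ∀ F ∈ (orderComplex {r : L.FacePoset | r.1 ⊂ s}).faces, (⟨s, h⟩ : L.FacePoset) ∉ F :=
  fun _ hF hmem => (lt_irrefl s) (hF.1 hmem)

theorem sdChain_mem (L : OrdComplex V) (n : ℕ) : ∀ s ∈ L.faces, s.card = n →
    sdChain 𝕜 L (Finsupp.single s 1) ∈
      (orderComplex {r : L.FacePoset | r.1 ⊆ s}).chains 𝕜 n := by
  induction n with
  | zero =>
    intro s _ hn
    rw [Finset.card_eq_zero] at hn
    subst hn
    rw [sdChain_empty]
    exact single_mem_chains 𝕜 (orderComplex _).empty_mem rfl 1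
  | succ n ih =>
    intro s hs hn
    have h : s ∈ L.faces ∧ s.Nonempty := ⟨hs, Finset.card_pos.mp (by omega)⟩
    rw [sdChain_single 𝕜 h]
    exact (cone_spec 𝕜 (sd_cone_notMem h) (sd_cone_faces h)
      (sdChain_boundary_mem 𝕜 hs hn ih)).1

theorem sdChain_comm (L : OrdComplex V) (n : ℕ) : ∀ c ∈ L.chains 𝕜 n,
    boundary 𝕜 L.FacePoset (sdChain 𝕜 L c) = sdChain 𝕜 L (boundary 𝕜 V c) := by
  induction n with
  | zero =>
    intro c hc
    suffices L.chains 𝕜 0 ≤ LinearMap.eqLocus (boundary 𝕜 L.FacePoset ∘ₗ sdChain 𝕜 L)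
      (sdChain 𝕜 L ∘ₗ boundary 𝕜 V) from this hc
    refine chains_le 𝕜 fun s _ hn => ?_
    rw [Finset.card_eq_zero] at hn
    subst hn
    change boundary 𝕜 _ (sdChain 𝕜 L _) = sdChain 𝕜 L (boundary 𝕜 V _)
    rw [sdChain_empty, boundary_single, boundary_single]
    simp
  | succ n ih =>
    intro c hc
    suffices L.chains 𝕜 (n + 1) ≤ LinearMap.eqLocus (boundary 𝕜 L.FacePoset ∘ₗ sdChain 𝕜 L)
      (sdChain 𝕜 L ∘ₗ boundary 𝕜 V) from this hc
    refine chains_le 𝕜 fun s hs hn => ?_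
    have h : s ∈ L.faces ∧ s.Nonempty := ⟨hs, Finset.card_pos.mp (by omega)⟩
    have hs1 := single_mem_chains 𝕜 hs hn 1
    change boundary 𝕜 _ (sdChain 𝕜 L _) = sdChain 𝕜 L (boundary 𝕜 V _)
    rw [sdChain_single 𝕜 h, (cone_spec 𝕜 (sd_cone_notMem h) (sd_cone_faces h)
      (sdChain_boundary_mem 𝕜 hs hn (sdChain_mem 𝕜 L n))).2, ih _ (boundary_mem 𝕜 hs1),
      boundary_boundary 𝕜 hs1]
    simp

theorem isChainMap_sdChain {L K : OrdComplex V} (h : K.faces ⊆ L.faces) :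
    IsChainMap 𝕜 K (sd L K) (sdChain 𝕜 L) := by
  refine IsChainMap.of_faces fun s hs => ⟨?_, ?_⟩
  · refine chains_mono 𝕜 ?_ _ (sdChain_mem 𝕜 L _ s (h hs) rfl)
    exact fun F hF => ⟨fun r hr => K.down_closed s hs _ (hF.1 hr), hF.2⟩
  · exact sdChain_comm 𝕜 L _ _ (single_mem_chains 𝕜 (h hs) rfl 1)

end OrdComplex

open OrdComplex

/-- A crosscut of a poset `Q`: an antichain `C` such that every finite (nonempty) chain of `Q` has
some element of `C` comparable to all its members, and every (nonempty) bounded subset of `C`,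
bounded meaning bounded above or bounded below in `Q`, has a join or a meet in `Q`. -/
structure IsCrosscut {Q : Type*} [PartialOrder Q] (C : Set Q) : Prop where
  antichain : IsAntichain (· ≤ ·) C
  comparable : ∀ σ : Finset Q, σ.Nonempty → IsChain (· ≤ ·) (σ : Set Q) →
    ∃ c ∈ C, ∀ x ∈ σ, c ≤ x ∨ x ≤ c
  bounded : ∀ A : Set Q, A ⊆ C → A.Nonempty → (BddAbove A ∨ BddBelow A) →
    (∃ b, IsLUB A b) ∨ ∃ b, IsGLB A b

section Poset

variable {P : Type*} [PartialOrder P] [OrderBot P]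

/-- `P ∖ {0̂}`. -/
abbrev ProperPart (P : Type*) [PartialOrder P] [OrderBot P] : Type _ := {x : P // x ≠ ⊥}

/-- The type of atoms of `P`. (It does not inherit the order of `P`, so that a total order on it
can be chosen.) -/
structure AtomOf (P : Type*) [PartialOrder P] [OrderBot P] where
  val : P
  isAtom : IsAtom val

/-- An atom as an element of `P ∖ {0̂}`. -/
def AtomOf.toProper (x : AtomOf P) : ProperPart P := ⟨x.val, x.isAtom.1⟩

/-- The set of atoms, as a subset of `P ∖ {0̂}`. -/
def atomSet (P : Type*) [PartialOrder P] [OrderBot P] : Set (ProperPart P) :=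
  {x | IsAtom x.1}

/-- `D_l`, the order complex of the half-open interval `(0̂, l]`. -/
def halfOpen (l : P) : OrdComplex (ProperPart P) := orderComplex {x | x.1 ≤ l}

/-- `Δ_a`, the order complex of the open interval `(0̂, a)`. -/
def Delta (a : P) : OrdComplex (ProperPart P) := orderComplex {x | x.1 < a}

section Gamma

variable [LinearOrder (AtomOf P)]

/-- The crosscut complex `Γ(P, S)` of the set `S` of atoms: the finite bounded subsets of `S`, with
`P ∖ {0̂}` as the ambient poset. -/
def crosscutComplex (P : Type*) [PartialOrder P] [OrderBot P] [LinearOrder (AtomOf P)] :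
    OrdComplex (AtomOf P) where
  faces := {T | T = ∅ ∨ BddAbove (AtomOf.toProper '' (T : Set (AtomOf P))) ∨
    BddBelow (AtomOf.toProper '' (T : Set (AtomOf P)))}
  isChain _ _ := fun x _ y _ _ => le_total x y
  empty_mem := Or.inl rfl
  down_closed s hs t ht := by
    have h : AtomOf.toProper '' (t : Set (AtomOf P)) ⊆ AtomOf.toProper '' (s : Set (AtomOf P)) :=
      Set.image_mono (Finset.coe_subset.mpr ht)
    rcases hs with rfl | hs | hs
    · exact Or.inl (Finset.subset_empty.mp ht)
    · exact Or.inr (Or.inl (hs.mono h))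
    · exact Or.inr (Or.inr (hs.mono h))

/-- The full simplex on the atoms below `l`. -/
def atomSimplex (l : P) : OrdComplex (AtomOf P) where
  faces := {T | ∀ x ∈ T, x.val ≤ l}
  isChain _ _ := fun x _ y _ _ => le_total x y
  empty_mem := by simp
  down_closed _ hs _ ht := fun x hx => hs x (ht hx)

/-- `Γ_a`, the union over `l ⋖ a` of the simplices on the atoms below `l`. -/
def Gamma (a : P) : OrdComplex (AtomOf P) := union {l | l ⋖ a} atomSimplex

end Gamma

/-- The union of the `D_b` over the `b ⋖ a` other than `l`. -/
def DeltaOther (a l : P) : OrdComplex (ProperPart P) := union {b | b ⋖ a ∧ b ≠ l} halfOpen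

theorem delta_cover [IsStronglyCoatomic P] {a l : P} (h : l ⋖ a) :
    (Delta a).faces = (halfOpen l).faces ∪ (DeltaOther a l).faces := by
  ext s
  constructor
  · rintro ⟨h1, h2⟩
    rcases s.eq_empty_or_nonempty with rfl | hne
    · exact Or.inl (halfOpen l).empty_mem
    · obtain ⟨m, hm, hmax⟩ := s.exists_maximal hne
      have hle : ∀ x ∈ s, x ≤ m := fun x hx => by
        rcases h2.total hx hm with h | h
        · exact h
        · exact hmax hx h
      obtain ⟨b, hmb, hb⟩ := exists_le_covBy_of_lt (show m.1 < a from h1 hm)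
      have hs : s ∈ (halfOpen b).faces := ⟨fun x hx => le_trans (hle x hx) hmb, h2⟩
      by_cases hbl : b = l
      · subst hbl; exact Or.inl hs
      · exact Or.inr (Or.inr ⟨b, ⟨hb, hbl⟩, hs⟩)
  · rintro (hs | rfl | ⟨b, ⟨hb, -⟩, hs⟩)
    · exact ⟨fun x hx => lt_of_le_of_lt (hs.1 hx) h.lt, hs.2⟩
    · exact (Delta a).empty_mem
    · exact ⟨fun x hx => lt_of_le_of_lt (hs.1 hx) hb.lt, hs.2⟩

theorem cover_eq_of_le {a b l : P} (h : l ⋖ a) (hb : b ⋖ a) (hlb : l ≤ b) : b = l :=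
  (h.eq_or_eq hlb hb.le).resolve_right hb.ne

theorem delta_inter {a l : P} (h : l ⋖ a) :
    ((halfOpen l).inter (DeltaOther a l)).faces ⊆ (Delta l).faces := by
  rintro s ⟨hs, rfl | ⟨b, ⟨hb, hbl⟩, hs'⟩⟩
  · exact (Delta l).empty_mem
  · refine ⟨fun x hx => lt_of_le_of_ne (hs.1 hx) fun hxl => hbl ?_, hs.2⟩
    have : l ≤ b := hxl ▸ hs'.1 hx
    exact cover_eq_of_le h hb this

section Gamma

variable [LinearOrder (AtomOf P)]

/-- The union over the `b ⋖ a` other than `l` of the simplices on the atoms below `b`. -/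
def GammaOther (a l : P) : OrdComplex (AtomOf P) := union {b | b ⋖ a ∧ b ≠ l} atomSimplex

theorem gamma_cover {a l : P} (h : l ⋖ a) :
    (Gamma a).faces = (atomSimplex l).faces ∪ (GammaOther a l).faces := by
  ext s
  constructor
  · rintro (rfl | ⟨b, hb, hs⟩)
    · exact Or.inl (atomSimplex l).empty_mem
    · by_cases hbl : b = l
      · subst hbl; exact Or.inl hs
      · exact Or.inr (Or.inr ⟨b, ⟨hb, hbl⟩, hs⟩)
  · rintro (hs | rfl | ⟨b, ⟨hb, -⟩, hs⟩)
    · exact Or.inr ⟨l, h, hs⟩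
    · exact (Gamma a).empty_mem
    · exact Or.inr ⟨b, hb, hs⟩

theorem gamma_inter [IsStronglyCoatomic P] (hC : IsCrosscut (atomSet P)) {a l : P} (h : l ⋖ a) :
    ((atomSimplex l).inter (GammaOther a l)).faces ⊆ (Gamma l).faces := by
  rintro s ⟨hs, rfl | ⟨b, ⟨hb, hbl⟩, hs'⟩⟩
  · exact (Gamma l).empty_mem
  rcases s.eq_empty_or_nonempty with rfl | ⟨x, hx⟩
  · exact (Gamma l).empty_mem
  have hne : ∀ {c : P}, (∀ y ∈ s, y.val ≤ c) → c ≠ ⊥ := fun {c} hc hc0 =>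
    x.isAtom.1 (le_bot_iff.mp (hc0 ▸ hc x hx))
  have hub : ∀ {c : P} (hc : ∀ y ∈ s, y.val ≤ c), (⟨c, hne hc⟩ : ProperPart P) ∈
      upperBounds (AtomOf.toProper '' (s : Set (AtomOf P))) := by
    rintro c hc _ ⟨y, hy, rfl⟩
    exact hc y hy
  have key : ∃ j : P, (∀ y ∈ s, y.val ≤ j) ∧ j ≤ l ∧ j ≤ b := by
    rcases hC.bounded (AtomOf.toProper '' (s : Set (AtomOf P)))
      (by rintro _ ⟨y, -, rfl⟩; exact y.isAtom) ⟨_, x, hx, rfl⟩ (Or.inl ⟨_, hub hs⟩)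
      with ⟨j, hj⟩ | ⟨g, hg⟩
    · exact ⟨j.1, fun y hy => hj.1 ⟨y, hy, rfl⟩, hj.2 (hub hs), hj.2 (hub hs')⟩
    · have hgy : ∀ y ∈ s, g.1 = y.val := fun y hy =>
        (y.isAtom.le_iff.mp (hg.1 ⟨y, hy, rfl⟩)).resolve_left g.2
      exact ⟨g.1, fun y hy => (hgy y hy).ge, (hgy x hx).le.trans (hs x hx),
        (hgy x hx).le.trans (hs' x hx)⟩
  obtain ⟨j, hj, hjl, hjb⟩ := key
  have hlt : j < l := lt_of_le_of_ne hjl fun e => hbl (cover_eq_of_le h hb (e ▸ hjb))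
  obtain ⟨m, hjm, hm⟩ := exists_le_covBy_of_lt hlt
  exact Or.inr ⟨m, hm, fun y hy => (hj y hy).trans hjm⟩

end Gamma

variable (𝕜 : Type*) [CommRing 𝕜]

/-- The map `H̃_n(Δ_a) → H̃_{n-1}(Δ_l)` for `l ⋖ a`: the Mayer–Vietoris connecting map of
`Δ_a = D_l ∪ ⋃_{b ⋖ a, b ≠ l} D_b`, followed by the map induced by the inclusion of the
intersection into `Δ_l`. -/
def phiDelta [IsStronglyCoatomic P] {a l : P} (h : l ⋖ a) (n : ℕ) :
    (Delta a).Homology 𝕜 (n + 1) →ₗ[𝕜] (Delta l).Homology 𝕜 n :=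
  inclusionMap 𝕜 (delta_inter h) n ∘ₗ mayerVietoris (delta_cover h) n

/-- The analogous map `H̃_n(Γ_a) → H̃_{n-1}(Γ_l)`. That the intersection lies in `Γ_l` rests on
the crosscut property. -/
def phiGamma [LinearOrder (AtomOf P)] [IsStronglyCoatomic P] (hC : IsCrosscut (atomSet P))
    {a l : P} (h : l ⋖ a) (n : ℕ) :
    (Gamma a).Homology 𝕜 (n + 1) →ₗ[𝕜] (Gamma l).Homology 𝕜 n :=
  inclusionMap 𝕜 (gamma_inter hC h) n ∘ₗ mayerVietoris (gamma_cover h) n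

section Sequence

variable {V : Type*} [PartialOrder V]

/-- `φ₁ : C₁ = ⨁_{a ≠ 0̂} H̃_{-1}(K_a) → C₀ = H̃_{-1}(∅)` for a family `K_a` of complexes with
`K_a` empty for atoms `a`: the identity of `H̃_{-1}(∅)` on the component of each atom, and `0` on
the other components. -/
def seqAugmentation (K : P → OrdComplex V)
    (hK : ∀ a, IsAtom a → (K a).faces ⊆ (emptyComplex V).faces) :
    (⨁ a : ProperPart P, (K a.1).Homology 𝕜 0) →ₗ[𝕜] (emptyComplex V).Homology 𝕜 0 :=
  open Classical in
  DirectSum.toModule 𝕜 (ProperPart P) _ fun a =>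
    if h : IsAtom a.1 then inclusionMap 𝕜 (hK a.1 h) 0 else 0

instance [LocallyFiniteOrder P] (a : P) : Finite {l : ProperPart P // l.1 ⋖ a} := by
  have : (Set.Icc ⊥ a).Finite := Set.finite_Icc ⊥ a
  have := this.to_subtype
  exact Finite.of_injective
    (fun l : {l : ProperPart P // l.1 ⋖ a} => (⟨l.1.1, bot_le, l.2.le⟩ : Set.Icc ⊥ a))
    fun x y h => Subtype.ext (Subtype.ext (Subtype.mk.inj h))

open Classical in
/-- `φ_{n+2} : C_{n+2} = ⨁_{a ≠ 0̂} H̃_n(K_a) → C_{n+1} = ⨁_{a ≠ 0̂} H̃_{n-1}(K_a)`, given on the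
component of `a` by the sum over `l ⋖ a` of the given maps `φ a l`. -/
def seqDifferential [LocallyFiniteOrder P] (K : P → OrdComplex V) (n : ℕ)
    (φ : ∀ a l : P, l ⋖ a → (K a).Homology 𝕜 (n + 1) →ₗ[𝕜] (K l).Homology 𝕜 n) :
    (⨁ a : ProperPart P, (K a.1).Homology 𝕜 (n + 1)) →ₗ[𝕜]
      ⨁ a : ProperPart P, (K a.1).Homology 𝕜 n :=
  letI (a : ProperPart P) : Fintype {l : ProperPart P // l.1 ⋖ a.1} := Fintype.ofFinite _
  DirectSum.toModule 𝕜 (ProperPart P) _ fun a =>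
    ∑ l : {l : ProperPart P // l.1 ⋖ a.1},
      DirectSum.lof 𝕜 (ProperPart P) (fun b => (K b.1).Homology 𝕜 n) l.1 ∘ₗ φ a.1 l.1.1 l.2

end Sequence

theorem delta_atom {a : P} (h : IsAtom a) :
    (Delta a).faces ⊆ (emptyComplex (ProperPart P)).faces := by
  rintro s ⟨hs, -⟩
  refine Finset.eq_empty_of_forall_notMem fun x hx => x.2 (h.lt_iff.mp (hs hx))

theorem gamma_atom [LinearOrder (AtomOf P)] {a : P} (h : IsAtom a) :
    (Gamma a).faces ⊆ (emptyComplex (AtomOf P)).faces := by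
  rintro s (rfl | ⟨l, hl, hs⟩)
  · rfl
  · refine Finset.eq_empty_of_forall_notMem fun x hx => x.isAtom.1 ?_
    exact le_bot_iff.mp ((hs x hx).trans (h.lt_iff.mp hl.lt).le)

section Bjorner

variable [LocallyFiniteOrder P]

theorem commonAtoms_finite {σ : Finset (ProperPart P)} (h : σ.Nonempty) :
    {x : AtomOf P | ∀ a ∈ σ, x.val ≤ a.1}.Finite := by
  obtain ⟨a, ha⟩ := h
  refine Set.Finite.of_injOn (f := AtomOf.val) (t := Set.Icc ⊥ a.1)
    (fun x hx => ⟨bot_le, hx a ha⟩) ?_ (Set.finite_Icc _ _)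
  rintro ⟨x, hx⟩ _ ⟨y, hy⟩ _ h
  cases h
  rfl

variable [LinearOrder (AtomOf P)]

/-- The order-reversing map of face posets from the order complex of `P ∖ {0̂}` to `Γ(P, S)` that
sends a nonempty chain `σ` to the set of atoms `x` with `σ ⊆ P_{≥ x}`. -/
def commonAtoms (σ : (orderComplex (Set.univ : Set (ProperPart P))).FacePoset) :
    (crosscutComplex P).FacePoset :=
  ⟨(commonAtoms_finite σ.2.2).toFinset, by
    obtain ⟨a, ha⟩ := σ.2.2
    refine Or.inr (Or.inl ⟨a, ?_⟩)
    rintro _ ⟨x, hx, rfl⟩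
    rw [Set.Finite.coe_toFinset] at hx
    exact hx a ha, by
    obtain ⟨m, hm, hmin⟩ := σ.1.exists_minimal σ.2.2
    obtain ⟨x, hx, hxm⟩ := exists_covBy_le_of_lt (bot_lt_iff_ne_bot.mpr m.2)
    refine ⟨⟨x, bot_covBy_iff.mp hx⟩, ?_⟩
    rw [Set.Finite.mem_toFinset]
    intro a ha
    refine le_trans hxm ?_
    rcases σ.2.1.2.total hm ha with h | h
    · exact h
    · exact hmin ha h⟩

/-- The vertex map from the barycentric subdivision of `Γ(P, S)` to `Γ(P, S)` that sends a nonempty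
set of atoms to its least element in the chosen total order. -/
def unsd (T : (crosscutComplex P).FacePoset) : AtomOf P := T.1.min' T.2.2

theorem commonAtoms_le {σ τ : (orderComplex (Set.univ : Set (ProperPart P))).FacePoset}
    (h : σ ≤ τ) : commonAtoms τ ≤ commonAtoms σ := by
  intro x hx
  simp only [commonAtoms, Set.Finite.mem_toFinset] at hx ⊢
  exact fun a ha => hx a (h ha)

/-- Björner's homotopy equivalence on the level of chains: subdivide, apply the simplicial map of
subdivisions induced by `commonAtoms`, and undo the subdivision by `unsd`. -/
def bjornerChain : (Finset (ProperPart P) →₀ 𝕜) →ₗ[𝕜] (Finset (AtomOf P) →₀ 𝕜) :=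
  push 𝕜 (unsd (P := P)) ∘ₗ push 𝕜 commonAtoms ∘ₗ
    sdChain 𝕜 (orderComplex (Set.univ : Set (ProperPart P)))

theorem isChainMap_bjorner {K : OrdComplex (ProperPart P)} {G : OrdComplex (AtomOf P)}
    (h : ∀ σ : (orderComplex (Set.univ : Set (ProperPart P))).FacePoset,
      σ.1 ∈ K.faces → (commonAtoms σ).1 ∈ G.faces) :
    IsChainMap 𝕜 K G (bjornerChain 𝕜) := by
  refine IsChainMap.comp (L := sd (crosscutComplex P) G) ?_
    (IsChainMap.comp (L := sd (orderComplex Set.univ) K) ?_ ?_)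
  · refine isChainMap_push 𝕜 _ fun F hF T hT => ?_
    rcases F.eq_empty_or_nonempty with rfl | hne
    · rw [Finset.coe_empty, Set.image_empty, Finset.coe_eq_empty] at hT
      rw [hT]
      exact G.empty_mem
    · obtain ⟨m, hm, hmax⟩ := F.exists_maximal hne
      refine G.down_closed m.1 (hF.1 hm) T fun x hx => ?_
      have hx' : x ∈ unsd '' (F : Set (crosscutComplex P).FacePoset) := hT ▸ hx
      obtain ⟨t, ht, rfl⟩ := hx'
      have htm : t ≤ m := by
        rcases hF.2.total ht hm with h | h
        · exact h
        · exact hmax ht h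
      exact htm (Finset.min'_mem _ _)
  · refine isChainMap_push 𝕜 _ fun F hF T hT => ⟨?_, ?_⟩
    · rw [hT]
      rintro _ ⟨σ, hσ, rfl⟩
      exact h σ (hF.1 hσ)
    · rw [hT]
      rintro _ ⟨σ, hσ, rfl⟩ _ ⟨τ, hτ, rfl⟩ _
      rcases hF.2.total hσ hτ with h | h
      · exact Or.inr (commonAtoms_le h)
      · exact Or.inl (commonAtoms_le h)
  · exact isChainMap_sdChain 𝕜 fun s hs => ⟨Set.subset_univ _, K.isChain s hs⟩

theorem commonAtoms_mem_gamma (a : P)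
    (σ : (orderComplex (Set.univ : Set (ProperPart P))).FacePoset)
    (hσ : σ.1 ∈ (Delta a).faces) : (commonAtoms σ).1 ∈ (Gamma a).faces := by
  obtain ⟨x, hx⟩ := σ.2.2
  obtain ⟨l, hxl, hl⟩ := exists_le_covBy_of_lt (show x.1 < a from hσ.1 hx)
  refine Or.inr ⟨l, hl, fun y hy => ?_⟩
  simp only [commonAtoms, Set.Finite.mem_toFinset] at hy
  exact (hy x hx).trans hxl

/-- The map `H̃_{n-1}(Δ_a) → H̃_{n-1}(Γ_a)` induced by Björner's map. -/
def bjornerMap (a : P) (n : ℕ) :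
    (Delta a).Homology 𝕜 n →ₗ[𝕜] (Gamma a).Homology 𝕜 n :=
  homologyMap (isChainMap_bjorner 𝕜 (commonAtoms_mem_gamma a)) n

/-- The map induced by Björner's map on the homology of the empty complex. -/
def bjornerMapEmpty (n : ℕ) :
    (emptyComplex (ProperPart P)).Homology 𝕜 n →ₗ[𝕜] (emptyComplex (AtomOf P)).Homology 𝕜 n :=
  homologyMap (isChainMap_bjorner 𝕜 fun σ hσ =>
    absurd (Set.mem_singleton_iff.mp hσ) σ.2.2.ne_empty) n

end Bjorner

end Poset

end

/-! Björner's map has an explicit homotopy inverse on the level of chains: subdivide a face of the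
crosscut complex and send each nonempty set of atoms to its join (`joinChain`). The joins exist
because `S` is a crosscut. A bounded set of atoms has a join or a meet, and atoms with a common
lower bound in `P ∖ {0̂}` all coincide, so in the second case the set is a single atom and is its
own join. Both maps respect the local pieces: `bjornerChain` takes `D_l` to `Σ_l`, and `joinChain`
takes `Σ_l` to `D_l`. Hence the two composites preserve every `D_l` and every `Σ_l`. On `Δ_α` a
nonempty chain `s` lies in `D_m` for `m = max s`. On `Γ_α` a nonempty face `T` lies in `Σ_j` for `j`
its join. These pieces form monotone families of cones inside `Δ_α` and `Γ_α` that carry the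
composite and the identity alike, so the method of acyclic carriers (`carriedHomotopy_spec`,
`sub_mem_boundaries_of_carrier`) makes the two chain homotopic. This is `bjornerMap_bijective`.
Compatibility with the `φ` maps is naturality of the Mayer–Vietoris connecting map
(`homologyMap_comp_connecting`): Björner's map sends each of the two parts of `Δ_α` into the
corresponding part of `Γ_α`, so the image of a splitting is again a splitting. The statements about
the sequences follow component by component. -/

noncomputable section

open OrdComplex

namespace OrdComplex

variable {V W : Type*} [PartialOrder V] [PartialOrder W] {𝕜 : Type*} [CommRing 𝕜]

/-! ### Cones and acyclicity -/

variable (𝕜) in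
/-- Acyclicity: every reduced cycle bounds. -/
def IsAcyclic (K : OrdComplex V) : Prop :=
  ∀ n, K.cycles 𝕜 n ≤ K.boundaries 𝕜 n

theorem cone_single_of_mem {v : V} {s : Finset V} (hv : v ∈ s) (a : 𝕜) :
    cone 𝕜 v (Finsupp.single s a) = 0 := by
  simp [cone, hv]

/-- This extends `cone_spec` to complexes that contain the apex. If `v ∈ s`, the cone on `s`
vanishes, and among the faces of `s` only `s.erase v` has a nonzero cone, which is `s` with a
squared sign. Otherwise `cone_spec` applies to the full simplex on `s`. -/
theorem boundary_cone_single {K : OrdComplex V} {v : V}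
    (h : ∀ s ∈ K.faces, ∀ t : Finset V, (t : Set V) = Set.insert v s → t ∈ K.faces)
    {s : Finset V} (hs : s ∈ K.faces) :
    cone 𝕜 v (Finsupp.single s 1) ∈ K.chains 𝕜 (s.card + 1) ∧
      boundary 𝕜 V (cone 𝕜 v (Finsupp.single s 1)) =
        Finsupp.single s 1 - cone 𝕜 v (boundary 𝕜 V (Finsupp.single s 1)) := by
  classical
  by_cases hv : v ∈ s
  · rw [cone_single_of_mem hv]
    refine ⟨Submodule.zero_mem _, ?_⟩
    have hne : v ∉ s.erase v := Finset.notMem_erase v s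
    have hsq : sgn 𝕜 s v * sgn 𝕜 (s.erase v) v = 1 := by
      rw [sgn_erase_of_not_lt 𝕜 (lt_irrefl v)]
      unfold sgn
      rw [← pow_add, ← two_mul, pow_mul]
      simp
    have hrest : ∀ w ∈ s, w ≠ v →
        cone 𝕜 v (Finsupp.single (s.erase w) (sgn 𝕜 s w)) = 0 := fun w _ hw =>
      cone_single_of_mem (Finset.mem_erase.mpr ⟨hw.symm, hv⟩) _
    have hb : boundary 𝕜 V (Finsupp.single s 1) =
        ∑ w ∈ s, Finsupp.single (s.erase w) (sgn 𝕜 s w) := by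
      convert boundary_single 𝕜 s
    have hc : cone 𝕜 v (Finsupp.single (s.erase v) (sgn 𝕜 s v)) =
        Finsupp.single (insert v (s.erase v)) (sgn 𝕜 s v * sgn 𝕜 (s.erase v) v) := by
      convert cone_single 𝕜 hne (sgn 𝕜 s v)
    rw [map_zero, hb, map_sum, Finset.sum_eq_single_of_mem v hv hrest, hc,
      Finset.insert_erase hv, hsq, sub_self]
  · let L : OrdComplex V :=
      { faces := {t | t ⊆ s}
        isChain := fun t ht => (K.isChain s hs).mono (Finset.coe_subset.mpr ht)
        empty_mem := Finset.empty_subset s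
        down_closed := fun t ht u hu => Finset.Subset.trans hu ht }
    exact cone_spec 𝕜 (K := L) (L := K) (fun t ht hvt => hv (ht hvt))
      (fun t ht u hu => h t (K.down_closed s hs t ht) u hu)
      (single_mem_chains 𝕜 (K := L) (Finset.Subset.refl s) rfl 1)

/-- Coning with `v` is a contracting homotopy, so a cycle is the boundary of its own cone. Dimension
`-1` is covered as well: `∅` bounds `[v]`. -/
theorem isAcyclic_of_cone {K : OrdComplex V} (v : V)
    (h : ∀ s ∈ K.faces, ∀ t : Finset V, (t : Set V) = Set.insert v s → t ∈ K.faces) :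
    K.IsAcyclic 𝕜 := by
  intro n c hc
  have key : K.chains 𝕜 n ≤ (K.chains 𝕜 (n + 1)).comap (cone 𝕜 v) ⊓
      LinearMap.eqLocus (boundary 𝕜 V ∘ₗ cone 𝕜 v)
        (LinearMap.id - cone 𝕜 v ∘ₗ boundary 𝕜 V) := by
    refine chains_le 𝕜 fun s hs hn => ?_
    subst hn
    exact boundary_cone_single h hs
  obtain ⟨h1, h2⟩ := key hc.1
  refine ⟨cone 𝕜 v c, h1, ?_⟩
  have h3 : boundary 𝕜 V (cone 𝕜 v c) = c - cone 𝕜 v (boundary 𝕜 V c) := h2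
  rw [h3, show boundary 𝕜 V c = 0 from hc.2, map_zero, sub_zero]

/-! ### Acyclic carriers -/

open Classical in
variable (𝕜) in
/-- A chain of `L` with the given boundary, if there is one. -/
def filling (L : OrdComplex W) (n : ℕ) (c : Finset W →₀ 𝕜) : Finset W →₀ 𝕜 :=
  if h : ∃ e ∈ L.chains 𝕜 (n + 1), boundary 𝕜 W e = c then h.choose else 0

theorem filling_spec {L : OrdComplex W} (hL : L.IsAcyclic 𝕜) {n : ℕ} {c : Finset W →₀ 𝕜}
    (hc : c ∈ L.cycles 𝕜 n) :
    filling 𝕜 L n c ∈ L.chains 𝕜 (n + 1) ∧ boundary 𝕜 W (filling 𝕜 L n c) = c := by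
  have h : ∃ e ∈ L.chains 𝕜 (n + 1), boundary 𝕜 W e = c := hL n hc
  rw [filling, dif_pos h]
  exact h.choose_spec

open Classical in
/-- The chain homotopy carried by `Φ` from a chain map `D` to zero, on a face with the given number
of vertices. -/
def carriedHomotopyAux (Φ : Finset V → OrdComplex W)
    (D : (Finset V →₀ 𝕜) →ₗ[𝕜] (Finset W →₀ 𝕜)) : ℕ → Finset V → (Finset W →₀ 𝕜)
  -- Zero is the right start because `D` is assumed to vanish on the empty face when this is used.
  | 0, _ => 0
  | n + 1, s => filling 𝕜 (Φ s) (n + 1) (D (Finsupp.single s 1) -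
      ∑ v ∈ s, sgn 𝕜 s v • carriedHomotopyAux Φ D n (s.erase v))

/-- The chain homotopy carried by `Φ` from a chain map `D` to zero. -/
def carriedHomotopy (Φ : Finset V → OrdComplex W)
    (D : (Finset V →₀ 𝕜) →ₗ[𝕜] (Finset W →₀ 𝕜)) : (Finset V →₀ 𝕜) →ₗ[𝕜] (Finset W →₀ 𝕜) :=
  Finsupp.linearCombination 𝕜 fun s => carriedHomotopyAux Φ D s.card s

/-- The recursion in terms of the linear map itself: every facet of `s` has `n` vertices, so the
recursive calls add up to the homotopy applied to `∂ s`. -/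
theorem carriedHomotopy_single (Φ : Finset V → OrdComplex W)
    (D : (Finset V →₀ 𝕜) →ₗ[𝕜] (Finset W →₀ 𝕜)) {n : ℕ} {s : Finset V} (hn : s.card = n + 1) :
    carriedHomotopy Φ D (Finsupp.single s 1) = filling 𝕜 (Φ s) (n + 1) (D (Finsupp.single s 1) -
      carriedHomotopy Φ D (boundary 𝕜 V (Finsupp.single s 1))) := by
  classical
  rw [boundary_single, map_sum]
  rw [carriedHomotopy, Finsupp.linearCombination_single, one_smul, hn, carriedHomotopyAux]
  congr 2
  refine Finset.sum_congr rfl fun v hv => ?_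
  rw [Finsupp.linearCombination_single]
  congr 1
  have : (s.erase v).card = n := by rw [Finset.card_erase_of_mem hv, hn]; rfl
  rw [← this]

/-- A chain map that vanishes on the empty face and is carried by acyclic subcomplexes is
null-homotopic. -/
theorem carriedHomotopy_spec {K : OrdComplex V} {L : OrdComplex W} {Φ : Finset V → OrdComplex W}
    {D : (Finset V →₀ 𝕜) →ₗ[𝕜] (Finset W →₀ 𝕜)}
    (hcomm : ∀ n, ∀ c ∈ K.chains 𝕜 n, boundary 𝕜 W (D c) = D (boundary 𝕜 V c))
    (hempty : D (Finsupp.single ∅ 1) = 0)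
    (hmono : ∀ s ∈ K.faces, ∀ t ⊆ s, (Φ t).faces ⊆ (Φ s).faces)
    (hsub : ∀ s ∈ K.faces, s.Nonempty → (Φ s).faces ⊆ L.faces)
    (hacyc : ∀ s ∈ K.faces, s.Nonempty → (Φ s).IsAcyclic 𝕜)
    (hD : ∀ s ∈ K.faces, s.Nonempty → D (Finsupp.single s 1) ∈ (Φ s).chains 𝕜 s.card) (n : ℕ) :
    (∀ s ∈ K.faces, s.card = n →
      carriedHomotopy Φ D (Finsupp.single s 1) ∈ (Φ s).chains 𝕜 (n + 1)) ∧
    ∀ c ∈ K.chains 𝕜 n, carriedHomotopy Φ D c ∈ L.chains 𝕜 (n + 1) ∧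
      boundary 𝕜 W (carriedHomotopy Φ D c) = D c - carriedHomotopy Φ D (boundary 𝕜 V c) := by
  classical
  -- Both properties of chains are linear in `c`, so the induction step need only treat single
  -- faces.
  have hext : ∀ n, (∀ s ∈ K.faces, s.card = n →
      carriedHomotopy Φ D (Finsupp.single s 1) ∈ (Φ s).chains 𝕜 (n + 1) ∧
      carriedHomotopy Φ D (Finsupp.single s 1) ∈ L.chains 𝕜 (n + 1) ∧
      boundary 𝕜 W (carriedHomotopy Φ D (Finsupp.single s 1)) = D (Finsupp.single s 1) -
        carriedHomotopy Φ D (boundary 𝕜 V (Finsupp.single s 1))) →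
      (∀ s ∈ K.faces, s.card = n →
        carriedHomotopy Φ D (Finsupp.single s 1) ∈ (Φ s).chains 𝕜 (n + 1)) ∧
      ∀ c ∈ K.chains 𝕜 n, carriedHomotopy Φ D c ∈ L.chains 𝕜 (n + 1) ∧
        boundary 𝕜 W (carriedHomotopy Φ D c) = D c - carriedHomotopy Φ D (boundary 𝕜 V c) := by
    refine fun n h => ⟨fun s hs hn => (h s hs hn).1, fun c hc => ?_⟩
    suffices K.chains 𝕜 n ≤ (L.chains 𝕜 (n + 1)).comap (carriedHomotopy Φ D) ⊓
      LinearMap.eqLocus (boundary 𝕜 W ∘ₗ carriedHomotopy Φ D)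
        (D - carriedHomotopy Φ D ∘ₗ boundary 𝕜 V) from this hc
    exact chains_le 𝕜 fun s hs hn => (h s hs hn).2
  induction n with
  | zero =>
    refine hext _ fun s _ hn => ?_
    rw [Finset.card_eq_zero] at hn
    subst hn
    -- The zero chain lies in every complex, so nothing is required of `Φ ∅`. This matters: for the
    -- carriers used below, `Φ ∅` has no vertices and so need not be acyclic.
    have h0 : carriedHomotopy Φ D (Finsupp.single ∅ 1) = 0 := by
      simp [carriedHomotopy, carriedHomotopyAux]
    have h1 : boundary 𝕜 V (Finsupp.single ∅ 1) = 0 := by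
      rw [boundary_single]; simp
    rw [h0, h1, hempty]
    simp
  | succ n ih =>
    refine hext _ fun s hs hn => ?_
    have hne : s.Nonempty := Finset.card_pos.mp (by omega)
    have hs1 := single_mem_chains 𝕜 hs hn (1 : 𝕜)
    -- The homotopy on a facet is carried by a smaller complex, which monotonicity places inside `Φ
    -- s`.
    have hbd : carriedHomotopy Φ D (boundary 𝕜 V (Finsupp.single s 1)) ∈
        (Φ s).chains 𝕜 (n + 1) := by
      rw [boundary_single, map_sum]
      refine Submodule.sum_mem _ fun v hv => ?_
      rw [single_smul_one, map_smul]
      refine Submodule.smul_mem _ _ (chains_mono 𝕜 (hmono s hs _ (Finset.erase_subset v s)) _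
        (ih.1 _ (K.down_closed s hs _ (Finset.erase_subset _ _)) ?_))
      rw [Finset.card_erase_of_mem hv, hn]; rfl
    -- With `H` the homotopy, induction gives `∂ (D s - H ∂ s) = D ∂ s - (D ∂ s - H ∂ ∂ s) = 0`, so
    -- this chain can be filled inside `Φ s`.
    have hcyc : D (Finsupp.single s 1) - carriedHomotopy Φ D (boundary 𝕜 V (Finsupp.single s 1)) ∈
        (Φ s).cycles 𝕜 (n + 1) := by
      refine ⟨Submodule.sub_mem _ (hn ▸ hD s hs hne) hbd, ?_⟩
      change boundary 𝕜 W (_ - _) = 0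
      rw [map_sub, hcomm _ _ hs1, (ih.2 _ (boundary_mem 𝕜 hs1)).2,
        boundary_boundary 𝕜 hs1]
      simp
    have hfill := filling_spec (hacyc s hs hne) hcyc
    rw [← carriedHomotopy_single Φ D hn] at hfill
    exact ⟨hfill.1, chains_mono 𝕜 (hsub s hs hne) _ hfill.1, hfill.2⟩

/-- An endomorphism that is carried, together with the identity, by acyclic subcomplexes is the
identity on homology. -/
theorem sub_mem_boundaries_of_carrier {K : OrdComplex V} {Φ : Finset V → OrdComplex V}
    {F : (Finset V →₀ 𝕜) →ₗ[𝕜] (Finset V →₀ 𝕜)} (hF : IsChainMap 𝕜 K K F)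
    (hempty : F (Finsupp.single ∅ 1) = Finsupp.single ∅ 1)
    (hmono : ∀ s ∈ K.faces, ∀ t ⊆ s, (Φ t).faces ⊆ (Φ s).faces)
    (hsub : ∀ s ∈ K.faces, s.Nonempty → (Φ s).faces ⊆ K.faces)
    (hacyc : ∀ s ∈ K.faces, s.Nonempty → (Φ s).IsAcyclic 𝕜)
    (hid : ∀ s ∈ K.faces, s.Nonempty → s ∈ (Φ s).faces)
    (hcar : ∀ s ∈ K.faces, s.Nonempty → F (Finsupp.single s 1) ∈ (Φ s).chains 𝕜 s.card)
    {n : ℕ} {c : Finset V →₀ 𝕜} (hc : c ∈ K.cycles 𝕜 n) : F c - c ∈ K.boundaries 𝕜 n := by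
  have h := (carriedHomotopy_spec (K := K) (L := K) (Φ := Φ) (D := F - LinearMap.id)
    (fun n c hc => by simp [hF.comm n c hc]) (by simp [hempty]) hmono hsub hacyc
    (fun s hs hne => Submodule.sub_mem _ (hcar s hs hne)
      (single_mem_chains 𝕜 (hid s hs hne) rfl 1)) n).2 c hc.1
  refine ⟨_, h.1, ?_⟩
  rw [h.2, show boundary 𝕜 V c = 0 from hc.2]
  simp

/-! ### Induced maps on homology and naturality of the connecting map -/

theorem homologyMap_mk {K : OrdComplex V} {L : OrdComplex W}
    {F : (Finset V →₀ 𝕜) →ₗ[𝕜] (Finset W →₀ 𝕜)} (hF : IsChainMap 𝕜 K L F) (n : ℕ)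
    (c : K.cycles 𝕜 n) : homologyMap hF n (Submodule.Quotient.mk c) =
      Submodule.Quotient.mk ⟨F c.1, hF.map_cycles n c.1 c.2⟩ := rfl

theorem homologyMap_bijective_of_inverse {K : OrdComplex V} {L : OrdComplex W}
    {F : (Finset V →₀ 𝕜) →ₗ[𝕜] (Finset W →₀ 𝕜)} {G : (Finset W →₀ 𝕜) →ₗ[𝕜] (Finset V →₀ 𝕜)}
    (hF : IsChainMap 𝕜 K L F) (hG : IsChainMap 𝕜 L K G) (n : ℕ)
    (hGF : ∀ c ∈ K.cycles 𝕜 n, G (F c) - c ∈ K.boundaries 𝕜 n)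
    (hFG : ∀ c ∈ L.cycles 𝕜 n, F (G c) - c ∈ L.boundaries 𝕜 n) :
    Function.Bijective (homologyMap hF n) := by
  refine Function.bijective_iff_has_inverse.mpr ⟨homologyMap hG n, fun x => ?_, fun x => ?_⟩
  · obtain ⟨c, rfl⟩ := Submodule.Quotient.mk_surjective _ x
    rw [homologyMap_mk, homologyMap_mk, Submodule.Quotient.eq]
    exact hGF c.1 c.2
  · obtain ⟨c, rfl⟩ := Submodule.Quotient.mk_surjective _ x
    rw [homologyMap_mk, homologyMap_mk, Submodule.Quotient.eq]
    exact hFG c.1 c.2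

theorem push_empty (g : V → W) :
    push 𝕜 g (Finsupp.single ∅ 1) = Finsupp.single ∅ 1 := by
  classical
  simp [push, mapSign]

/-- Naturality of the Mayer–Vietoris connecting map followed by an inclusion. -/
theorem homologyMap_comp_connecting {A B K M : OrdComplex V} {A' B' K' M' : OrdComplex W}
    {F : (Finset V →₀ 𝕜) →ₗ[𝕜] (Finset W →₀ 𝕜)}
    (hK : K.faces = A.faces ∪ B.faces) (hK' : K'.faces = A'.faces ∪ B'.faces)
    (hM : (A.inter B).faces ⊆ M.faces) (hM' : (A'.inter B').faces ⊆ M'.faces)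
    (hA : IsChainMap 𝕜 A A' F) (hB : IsChainMap 𝕜 B B' F)
    (hFK : IsChainMap 𝕜 K K' F) (hFM : IsChainMap 𝕜 M M' F) (n : ℕ) :
    homologyMap hFM n ∘ₗ inclusionMap 𝕜 hM n ∘ₗ mayerVietoris hK n =
      (inclusionMap 𝕜 hM' n ∘ₗ mayerVietoris hK' n) ∘ₗ homologyMap hFK (n + 1) := by
  refine LinearMap.ext fun x => ?_
  obtain ⟨⟨c, hc⟩, rfl⟩ := Submodule.Quotient.mk_surjective _ x
  obtain ⟨a, b, ha, hb, rfl⟩ : ∃ a b, a ∈ A.chains 𝕜 (n + 1) ∧ b ∈ B.chains 𝕜 (n + 1) ∧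
      a + b = c :=
    ⟨_, _, (restrictTo_mem hK hc.1).1, (restrictTo_mem hK hc.1).2, add_sub_cancel _ _⟩
  -- The splitting `F a + F b` need not be the one that defines `mayerVietoris hK'`: part of `F b`
  -- may lie on faces of `A'`. Hence the use of `mayerVietoris_mk`, which allows any splitting.
  have hc' : F a + F b ∈ K'.cycles 𝕜 (n + 1) := by
    rw [← map_add]; exact hFK.map_cycles _ _ hc
  have e1 : homologyMap hFK (n + 1) (Submodule.Quotient.mk ⟨a + b, hc⟩) =
      Submodule.Quotient.mk ⟨F a + F b, hc'⟩ := by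
    rw [homologyMap_mk]
    congr 2
    exact map_add F a b
  simp only [LinearMap.comp_apply]
  rw [e1, mayerVietoris_mk hK n ha hb hc,
    mayerVietoris_mk hK' n (hA.map_mem _ _ ha) (hB.map_mem _ _ hb) hc']
  unfold inclusionMap
  rw [homologyMap_mk, homologyMap_mk, homologyMap_mk]
  congr 2
  exact (hA.comm _ _ ha).symm

end OrdComplex

section Poset

variable {P : Type*} [PartialOrder P] [OrderBot P]

/-! ### The maps of the sequences on single components -/

section Sequence

variable (𝕜 : Type*) [CommRing 𝕜] {V W : Type*} [PartialOrder V] [PartialOrder W]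

theorem seqAugmentation_lof_of_isAtom [DecidableEq (ProperPart P)] {K : P → OrdComplex V}
    (hK : ∀ a, IsAtom a → (K a).faces ⊆ (emptyComplex V).faces) {a : ProperPart P}
    (h : IsAtom a.1) (x : (K a.1).Homology 𝕜 0) :
    seqAugmentation 𝕜 K hK
      (DirectSum.lof 𝕜 (ProperPart P) (fun b => (K b.1).Homology 𝕜 0) a x) =
        inclusionMap 𝕜 (hK a.1 h) 0 x := by
  classical
  rw [seqAugmentation]
  convert DirectSum.toModule_lof (M := fun b : ProperPart P => (K b.1).Homology 𝕜 0) 𝕜 a x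
  rw [dif_pos h]

theorem seqAugmentation_lof_of_not_isAtom [DecidableEq (ProperPart P)] {K : P → OrdComplex V}
    (hK : ∀ a, IsAtom a → (K a).faces ⊆ (emptyComplex V).faces) {a : ProperPart P}
    (h : ¬ IsAtom a.1) (x : (K a.1).Homology 𝕜 0) :
    seqAugmentation 𝕜 K hK
      (DirectSum.lof 𝕜 (ProperPart P) (fun b => (K b.1).Homology 𝕜 0) a x) = 0 := by
  classical
  rw [seqAugmentation]
  convert DirectSum.toModule_lof (M := fun b : ProperPart P => (K b.1).Homology 𝕜 0) 𝕜 a x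
  rw [dif_neg h, LinearMap.zero_apply]

theorem seqDifferential_lof [LocallyFiniteOrder P] [DecidableEq (ProperPart P)]
    {K : P → OrdComplex V} {n : ℕ}
    (φ : ∀ a l : P, l ⋖ a → (K a).Homology 𝕜 (n + 1) →ₗ[𝕜] (K l).Homology 𝕜 n)
    (a : ProperPart P) [Fintype {l : ProperPart P // l.1 ⋖ a.1}]
    (x : (K a.1).Homology 𝕜 (n + 1)) :
    seqDifferential 𝕜 K n φ
      (DirectSum.lof 𝕜 (ProperPart P) (fun b => (K b.1).Homology 𝕜 (n + 1)) a x) =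
        ∑ l : {l : ProperPart P // l.1 ⋖ a.1},
          DirectSum.lof 𝕜 (ProperPart P) (fun b => (K b.1).Homology 𝕜 n) l.1
            (φ a.1 l.1.1 l.2 x) := by
  classical
  rw [seqDifferential]
  convert DirectSum.toModule_lof (M := fun b : ProperPart P => (K b.1).Homology 𝕜 (n + 1)) 𝕜 a x
  rw [LinearMap.sum_apply]
  refine Finset.sum_congr ?_ fun l _ => ?_
  · congr!
  · rw [LinearMap.comp_apply]
    congr!

/-- It is enough to compare on one summand, where both sides are sums over the elements covered by
`a`; these agree term by term by the square for each cover relation. -/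
theorem lmap_comp_seqDifferential [LocallyFiniteOrder P]
    {K : P → OrdComplex V} {L : P → OrdComplex W} {n : ℕ}
    {φ : ∀ a l : P, l ⋖ a → (K a).Homology 𝕜 (n + 1) →ₗ[𝕜] (K l).Homology 𝕜 n}
    {ψ : ∀ a l : P, l ⋖ a → (L a).Homology 𝕜 (n + 1) →ₗ[𝕜] (L l).Homology 𝕜 n}
    {f : ∀ (a : P) (m : ℕ), (K a).Homology 𝕜 m →ₗ[𝕜] (L a).Homology 𝕜 m}
    (h : ∀ (a l : P) (hl : l ⋖ a), f l n ∘ₗ φ a l hl = ψ a l hl ∘ₗ f a (n + 1)) :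
    DirectSum.lmap (fun a : ProperPart P => f a.1 n) ∘ₗ seqDifferential 𝕜 K n φ =
      seqDifferential 𝕜 L n ψ ∘ₗ DirectSum.lmap (fun a : ProperPart P => f a.1 (n + 1)) := by
  classical
  refine DirectSum.linearMap_ext 𝕜 fun a => LinearMap.ext fun x => ?_
  let _ : Fintype {l : ProperPart P // l.1 ⋖ a.1} := Fintype.ofFinite _
  simp only [LinearMap.comp_apply, DirectSum.lmap_lof]
  rw [seqDifferential_lof, seqDifferential_lof, map_sum]
  refine Finset.sum_congr rfl fun l _ => ?_
  rw [DirectSum.lmap_lof]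
  exact congrArg _ (LinearMap.congr_fun (h a.1 l.1.1 l.2) x)

end Sequence

/-! ### Joins of faces of the crosscut complex -/

theorem exists_isLUB_of_mem_crosscutComplex [LinearOrder (AtomOf P)]
    (hS : IsCrosscut (atomSet P)) (T : (crosscutComplex P).FacePoset) :
    ∃ j, IsLUB (AtomOf.toProper '' (T.1 : Set (AtomOf P))) j := by
  obtain ⟨x, hx⟩ := T.2.2
  -- A nonzero element below an atom equals it, so a common lower bound forces `T` to be one atom.
  -- This settles the case in which the crosscut property gives only a meet.
  have hglb : ∀ g, g ∈ lowerBounds (AtomOf.toProper '' (T.1 : Set (AtomOf P))) →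
      ∃ j, IsLUB (AtomOf.toProper '' (T.1 : Set (AtomOf P))) j := by
    intro g hg
    have hgy : ∀ y ∈ T.1, g = y.toProper := fun y hy => Subtype.ext
      ((y.isAtom.le_iff.mp (hg ⟨y, hy, rfl⟩)).resolve_left g.2)
    refine ⟨g, ?_, fun u hu => ?_⟩
    · rintro _ ⟨y, hy, rfl⟩
      exact (hgy y hy).ge
    · rw [hgy x hx]
      exact hu ⟨x, hx, rfl⟩
  rcases hS.bounded (AtomOf.toProper '' (T.1 : Set (AtomOf P)))
      (by rintro _ ⟨y, -, rfl⟩; exact y.isAtom) ⟨_, x, hx, rfl⟩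
      (T.2.1.resolve_left (Finset.nonempty_iff_ne_empty.mp T.2.2)) with h | ⟨g, hg⟩
  · exact h
  · exact hglb g hg.1

/-- The join of a nonempty face of the crosscut complex. -/
def atomJoin [LinearOrder (AtomOf P)] (hS : IsCrosscut (atomSet P))
    (T : (crosscutComplex P).FacePoset) : ProperPart P :=
  (exists_isLUB_of_mem_crosscutComplex hS T).choose

section

variable [LinearOrder (AtomOf P)]

theorem le_atomJoin (hS : IsCrosscut (atomSet P)) (T : (crosscutComplex P).FacePoset) {x : AtomOf P}
    (hx : x ∈ T.1) : x.val ≤ (atomJoin hS T).1 :=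
  (exists_isLUB_of_mem_crosscutComplex hS T).choose_spec.1 ⟨x, hx, rfl⟩

/-- The bound `u` may range over all of `P`: since `T` is nonempty, `u` lies above an atom and is
not `0̂`. -/
theorem atomJoin_le (hS : IsCrosscut (atomSet P)) (T : (crosscutComplex P).FacePoset) {u : P}
    (hu : ∀ x ∈ T.1, x.val ≤ u) : (atomJoin hS T).1 ≤ u := by
  obtain ⟨x, hx⟩ := T.2.2
  have hu0 : u ≠ ⊥ := fun h => x.isAtom.1 (le_bot_iff.mp (h ▸ hu x hx))
  have hub : (⟨u, hu0⟩ : ProperPart P) ∈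
      upperBounds (AtomOf.toProper '' (T.1 : Set (AtomOf P))) := by
    rintro _ ⟨y, hy, rfl⟩
    exact hu y hy
  exact (exists_isLUB_of_mem_crosscutComplex hS T).choose_spec.2 hub

theorem atomJoin_mono (hS : IsCrosscut (atomSet P)) {T U : (crosscutComplex P).FacePoset}
    (h : T ≤ U) : atomJoin hS T ≤ atomJoin hS U :=
  atomJoin_le hS T fun _ hx => le_atomJoin hS U (h hx)

theorem mem_crosscutComplex_of_le {T : Finset (AtomOf P)} {u : P} (hu : ∀ x ∈ T, x.val ≤ u) :
    T ∈ (crosscutComplex P).faces := by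
  rcases T.eq_empty_or_nonempty with rfl | ⟨x, hx⟩
  · exact (crosscutComplex P).empty_mem
  · have hu0 : u ≠ ⊥ := fun h => x.isAtom.1 (le_bot_iff.mp (h ▸ hu x hx))
    refine Or.inr (Or.inl ⟨⟨u, hu0⟩, ?_⟩)
    rintro _ ⟨y, hy, rfl⟩
    exact hu y hy

theorem gamma_subset_crosscutComplex (a : P) :
    (Gamma a).faces ⊆ (crosscutComplex P).faces := by
  rintro T (rfl | ⟨l, -, hT⟩)
  · exact (crosscutComplex P).empty_mem
  · exact mem_crosscutComplex_of_le hT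

/-! ### The homotopy inverse given by joins -/

variable (𝕜 : Type*) [CommRing 𝕜]

/-- The homotopy inverse of `bjornerChain`: subdivide and send each face to its join. -/
def joinChain (hS : IsCrosscut (atomSet P)) :
    (Finset (AtomOf P) →₀ 𝕜) →ₗ[𝕜] (Finset (ProperPart P) →₀ 𝕜) :=
  push 𝕜 (atomJoin hS) ∘ₗ sdChain 𝕜 (crosscutComplex P)

theorem joinChain_empty (hS : IsCrosscut (atomSet P)) :
    joinChain 𝕜 hS (Finsupp.single ∅ 1) = Finsupp.single ∅ 1 := by
  simp only [joinChain, LinearMap.comp_apply]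
  rw [sdChain_empty, push_empty]

/-- Joins are monotone, so flags of faces go to chains of `P`; it remains only to know where the
joins lie. -/
theorem isChainMap_joinChain (hS : IsCrosscut (atomSet P)) {G : OrdComplex (AtomOf P)}
    (hG : G.faces ⊆ (crosscutComplex P).faces) {A : Set (ProperPart P)}
    (h : ∀ T : (crosscutComplex P).FacePoset, T.1 ∈ G.faces → atomJoin hS T ∈ A) :
    IsChainMap 𝕜 G (orderComplex A) (joinChain 𝕜 hS) := by
  refine IsChainMap.comp (L := sd (crosscutComplex P) G) ?_ (isChainMap_sdChain 𝕜 hG)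
  refine isChainMap_push 𝕜 _ fun F hF t ht => ⟨?_, ?_⟩
  · rw [ht]
    rintro _ ⟨T, hT, rfl⟩
    exact h T (hF.1 hT)
  · rw [ht]
    rintro _ ⟨T, hT, rfl⟩ _ ⟨U, hU, rfl⟩ _
    rcases hF.2.total hT hU with h | h
    · exact Or.inl (atomJoin_mono hS h)
    · exact Or.inr (atomJoin_mono hS h)

theorem isChainMap_joinChain_atomSimplex (hS : IsCrosscut (atomSet P)) (l : P) :
    IsChainMap 𝕜 (atomSimplex l) (halfOpen l) (joinChain 𝕜 hS) :=
  isChainMap_joinChain 𝕜 hS (G := atomSimplex l) (fun _ hT => mem_crosscutComplex_of_le hT)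
    fun T hT => atomJoin_le hS T hT

theorem isChainMap_joinChain_gamma (hS : IsCrosscut (atomSet P)) (a : P) :
    IsChainMap 𝕜 (Gamma a) (Delta a) (joinChain 𝕜 hS) := by
  refine isChainMap_joinChain 𝕜 hS (gamma_subset_crosscutComplex a) fun T hT => ?_
  rcases hT with hT | ⟨l, hl, hT⟩
  · exact absurd hT T.2.2.ne_empty
  · exact lt_of_le_of_lt (atomJoin_le hS T hT) hl.lt

theorem isChainMap_joinChain_empty (hS : IsCrosscut (atomSet P)) :
    IsChainMap 𝕜 (emptyComplex (AtomOf P)) (emptyComplex (ProperPart P)) (joinChain 𝕜 hS) := by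
  refine IsChainMap.of_faces fun s hs => ?_
  rw [Set.mem_singleton_iff.mp hs, joinChain_empty]
  refine ⟨single_mem_chains 𝕜 (emptyComplex _).empty_mem rfl 1, ?_⟩
  rw [boundary_single, boundary_single]
  simp

end

/-! ### The two carriers -/

/-- The order complex of the elements below some member of `s`. -/
def chainCarrier (s : Finset (ProperPart P)) : OrdComplex (ProperPart P) :=
  orderComplex {x | ∃ y ∈ s, x ≤ y}

theorem exists_max_of_isChain {Q : Type*} [PartialOrder Q] {s : Finset Q}
    (hs : IsChain (· ≤ ·) (s : Set Q)) (hne : s.Nonempty) : ∃ m ∈ s, ∀ x ∈ s, x ≤ m := by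
  obtain ⟨m, hm, hmax⟩ := s.exists_maximal hne
  exact ⟨m, hm, fun x hx => (hs.total hx hm).elim id fun h => hmax hx h⟩

/-- The maximum of `s` is comparable to every vertex of the carrier, which is therefore a cone. -/
theorem isAcyclic_chainCarrier {𝕜 : Type*} [CommRing 𝕜] {s : Finset (ProperPart P)}
    (hs : IsChain (· ≤ ·) (s : Set (ProperPart P))) (hne : s.Nonempty) :
    (chainCarrier s).IsAcyclic 𝕜 := by
  obtain ⟨m, hm, hmax⟩ := exists_max_of_isChain hs hne
  refine isAcyclic_of_cone m fun t ht u hu => ⟨?_, ?_⟩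
  · rw [hu]
    rintro x (rfl | hx)
    · exact ⟨x, hm, le_rfl⟩
    · exact ht.1 hx
  · rw [hu]
    refine ht.2.insert fun b hb _ => Or.inr ?_
    obtain ⟨y, hy, hby⟩ := ht.1 hb
    exact hby.trans (hmax y hy)

section

variable [LinearOrder (AtomOf P)]

/-- The simplex on the atoms below every upper bound of `T`. -/
def atomCarrier (T : Finset (AtomOf P)) : OrdComplex (AtomOf P) where
  faces := {R | ∀ x ∈ R, ∀ u, (∀ y ∈ T, y.val ≤ u) → x.val ≤ u}
  isChain _ _ := fun x _ y _ _ => le_total x y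
  empty_mem := by simp
  down_closed _ hs _ ht := fun x hx => hs x (ht hx)

/-- A full simplex is a cone over any of its vertices, and each element of `T` is one. -/
theorem isAcyclic_atomCarrier {𝕜 : Type*} [CommRing 𝕜] {T : Finset (AtomOf P)}
    (hne : T.Nonempty) : (atomCarrier T).IsAcyclic 𝕜 := by
  obtain ⟨z, hz⟩ := hne
  refine isAcyclic_of_cone z fun t ht u hu x hx => ?_
  have hx' : x ∈ Set.insert z (t : Set (AtomOf P)) := hu ▸ hx
  rcases hx' with rfl | hx'
  · exact fun w hw => hw x hz
  · exact ht x hx'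

/-! ### Björner's map: bijectivity and compatibility -/

variable [LocallyFiniteOrder P] (𝕜 : Type*) [CommRing 𝕜]

theorem bjornerChain_empty :
    bjornerChain 𝕜 (P := P) (Finsupp.single ∅ 1) = Finsupp.single ∅ 1 := by
  simp only [bjornerChain, LinearMap.comp_apply]
  rw [sdChain_empty, push_empty, push_empty]

/-- An atom below all members of a nonempty chain in `(0̂, l]` is below `l`. This serves both the
carrier argument and the Mayer–Vietoris square. -/
theorem isChainMap_bjorner_halfOpen (l : P) :
    IsChainMap 𝕜 (halfOpen l) (atomSimplex l) (bjornerChain 𝕜) := by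
  refine isChainMap_bjorner 𝕜 fun σ hσ y hy => ?_
  obtain ⟨x, hx⟩ := σ.2.2
  simp only [commonAtoms, Set.Finite.mem_toFinset] at hy
  exact (hy x hx).trans (hσ.1 hx)

theorem isChainMap_bjorner_other (a l : P) :
    IsChainMap 𝕜 (DeltaOther a l) (GammaOther a l) (bjornerChain 𝕜) := by
  refine isChainMap_bjorner 𝕜 fun σ hσ => ?_
  rcases hσ with hσ | ⟨b, hb, hσ⟩
  · exact absurd hσ σ.2.2.ne_empty
  · refine Or.inr ⟨b, hb, fun y hy => ?_⟩
    obtain ⟨x, hx⟩ := σ.2.2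
    simp only [commonAtoms, Set.Finite.mem_toFinset] at hy
    exact (hy x hx).trans (hσ.1 hx)

theorem bjornerMap_bijective (hS : IsCrosscut (atomSet P)) (a : P) (n : ℕ) :
    Function.Bijective (bjornerMap 𝕜 a n) := by
  have hF := isChainMap_bjorner 𝕜 (commonAtoms_mem_gamma a)
  have hG := isChainMap_joinChain_gamma 𝕜 hS a
  refine homologyMap_bijective_of_inverse hF hG n ?_ ?_
  · refine fun c hc => sub_mem_boundaries_of_carrier (Φ := chainCarrier) (hG.comp hF)
      ?_ ?_ ?_ ?_ ?_ ?_ hc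
    · rw [LinearMap.comp_apply, bjornerChain_empty, joinChain_empty]
    · rintro s - t hts r ⟨hr, hr'⟩
      exact ⟨fun x hx => (hr hx).imp fun y hy => ⟨hts hy.1, hy.2⟩, hr'⟩
    · rintro s hs - r ⟨hr, hr'⟩
      refine ⟨fun x hx => ?_, hr'⟩
      obtain ⟨y, hy, hxy⟩ := hr hx
      exact lt_of_le_of_lt (show x.1 ≤ y.1 from hxy) (hs.1 hy)
    · exact fun s hs hne => isAcyclic_chainCarrier hs.2 hne
    · exact fun s hs _ => ⟨fun x hx => ⟨x, hx, le_rfl⟩, hs.2⟩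
    -- The chain `s` lies in `D_m` for its maximum `m`. The composite preserves `D_m` by way of
    -- `Σ_m`, and `D_m` is contained in the carrier of `s`.
    · intro s hs hne
      obtain ⟨m, hm, hmax⟩ := exists_max_of_isChain hs.2 hne
      have hsm : s ∈ (halfOpen m.1).faces := ⟨fun x hx => hmax x hx, hs.2⟩
      refine chains_mono 𝕜 (K := halfOpen m.1) ?_ _ (((isChainMap_joinChain_atomSimplex 𝕜 hS
        m.1).comp (isChainMap_bjorner_halfOpen 𝕜 m.1)).map_mem _ _
        (single_mem_chains 𝕜 hsm rfl 1))
      rintro r ⟨hr, hr'⟩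
      exact ⟨fun x hx => ⟨m, hm, hr hx⟩, hr'⟩
  · refine fun c hc => sub_mem_boundaries_of_carrier (Φ := atomCarrier) (hF.comp hG)
      ?_ ?_ ?_ ?_ ?_ ?_ hc
    · rw [LinearMap.comp_apply, joinChain_empty, bjornerChain_empty]
    · exact fun s _ t hts r hr x hx u hu => hr x hx u fun y hy => hu y (hts hy)
    -- Some `l ⋖ a` bounds `s`, and by definition of the carrier it then bounds every atom there.
    · rintro s (rfl | ⟨l, hl, hs⟩) hne r hr
      · exact absurd rfl hne.ne_empty
      · exact Or.inr ⟨l, hl, fun x hx => hr x hx l hs⟩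
    · exact fun s _ hne => isAcyclic_atomCarrier hne
    · exact fun s _ _ x hx u hu => hu x hx
    -- Now `s` lies in `Σ_j` for its join `j`, which the composite preserves by way of `D_j`. Since
    -- `j` is below every upper bound of `s`, `Σ_j` is contained in the carrier.
    · intro s hs hne
      let T : (crosscutComplex P).FacePoset := ⟨s, gamma_subset_crosscutComplex a hs, hne⟩
      have hsj : s ∈ (atomSimplex (atomJoin hS T).1).faces := fun x hx => le_atomJoin hS T hx
      refine chains_mono 𝕜 (K := atomSimplex (atomJoin hS T).1) ?_ _
        (((isChainMap_bjorner_halfOpen 𝕜 _).comp (isChainMap_joinChain_atomSimplex 𝕜 hS _)).map_mem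
          _ _ (single_mem_chains 𝕜 hsj rfl 1))
      exact fun r hr x hx u hu => (hr x hx).trans (atomJoin_le hS T hu)

/-- Both composites fix the empty face, and the conditions on nonempty faces are vacuous, so a
constant carrier will do. -/
theorem bjornerMapEmpty_bijective (hS : IsCrosscut (atomSet P)) (n : ℕ) :
    Function.Bijective (bjornerMapEmpty 𝕜 (P := P) n) := by
  have hF : IsChainMap 𝕜 (emptyComplex (ProperPart P)) (emptyComplex (AtomOf P))
      (bjornerChain 𝕜) := isChainMap_bjorner 𝕜 fun σ hσ =>
    absurd (Set.mem_singleton_iff.mp hσ) σ.2.2.ne_empty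
  have hG := isChainMap_joinChain_empty 𝕜 hS
  refine homologyMap_bijective_of_inverse hF hG n ?_ ?_
  · refine fun c hc => sub_mem_boundaries_of_carrier (Φ := fun _ => emptyComplex _) (hG.comp hF)
      ?_ (fun _ _ _ _ => subset_rfl) ?_ ?_ ?_ ?_ hc
    · rw [LinearMap.comp_apply, bjornerChain_empty, joinChain_empty]
    all_goals exact fun s hs hne => absurd (Set.mem_singleton_iff.mp hs) hne.ne_empty
  · refine fun c hc => sub_mem_boundaries_of_carrier (Φ := fun _ => emptyComplex _) (hF.comp hG)
      ?_ (fun _ _ _ _ => subset_rfl) ?_ ?_ ?_ ?_ hc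
    · rw [LinearMap.comp_apply, joinChain_empty, bjornerChain_empty]
    all_goals exact fun s hs hne => absurd (Set.mem_singleton_iff.mp hs) hne.ne_empty

theorem bjornerMap_comp_phiDelta (hS : IsCrosscut (atomSet P)) {a l : P} (h : l ⋖ a) (n : ℕ) :
    bjornerMap 𝕜 l n ∘ₗ phiDelta 𝕜 h n = phiGamma 𝕜 hS h n ∘ₗ bjornerMap 𝕜 a (n + 1) :=
  homologyMap_comp_connecting (delta_cover h) (gamma_cover h) (delta_inter h) (gamma_inter hS h)
    (isChainMap_bjorner_halfOpen 𝕜 l) (isChainMap_bjorner_other 𝕜 a l)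
    (isChainMap_bjorner 𝕜 (commonAtoms_mem_gamma a))
    (isChainMap_bjorner 𝕜 (commonAtoms_mem_gamma l)) n

theorem bjornerMapEmpty_comp_seqAugmentation :
    bjornerMapEmpty 𝕜 0 ∘ₗ seqAugmentation 𝕜 (Delta (P := P)) (fun _ => delta_atom) =
      seqAugmentation 𝕜 Gamma (fun _ => gamma_atom) ∘ₗ
        DirectSum.lmap (fun α : ProperPart P => bjornerMap 𝕜 α.1 0) := by
  classical
  refine DirectSum.linearMap_ext 𝕜 fun a => LinearMap.ext fun x => ?_
  simp only [LinearMap.comp_apply, DirectSum.lmap_lof]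
  by_cases h : IsAtom a.1
  · rw [seqAugmentation_lof_of_isAtom 𝕜 _ h, seqAugmentation_lof_of_isAtom 𝕜 _ h]
    obtain ⟨c, rfl⟩ := Submodule.Quotient.mk_surjective _ x
    -- The inclusions into the empty complex leave representing cycles unchanged, so both sides are
    -- the class of the same chain.
    rfl
  · rw [seqAugmentation_lof_of_not_isAtom 𝕜 _ h, seqAugmentation_lof_of_not_isAtom 𝕜 _ h,
      map_zero]

end

end Poset

end

/-! ### The theorem -/

theorem mainTheorem1 {𝕜 : Type*} [Field 𝕜] {P : Type*} [PartialOrder P] [OrderBot P]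
    [LocallyFiniteOrder P] [LinearOrder (AtomOf P)] (hS : IsCrosscut (atomSet P)) :
    (∀ (α β : P) (h : β ⋖ α) (i : ℕ), 1 ≤ i →
      Function.Bijective (bjornerMap 𝕜 α (i + 1)) ∧
      Function.Bijective (bjornerMap 𝕜 β i) ∧
      bjornerMap 𝕜 β i ∘ₗ phiDelta 𝕜 h i = phiGamma 𝕜 hS h i ∘ₗ bjornerMap 𝕜 α (i + 1)) ∧
    (Function.Bijective (bjornerMapEmpty 𝕜 (P := P) 0) ∧
      (∀ n, Function.Bijective
        (DirectSum.lmap fun α : ProperPart P => bjornerMap 𝕜 α.1 n)) ∧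
      bjornerMapEmpty 𝕜 0 ∘ₗ seqAugmentation 𝕜 (Delta (P := P)) (fun _ => delta_atom) =
        seqAugmentation 𝕜 Gamma (fun _ => gamma_atom) ∘ₗ
          DirectSum.lmap (fun α : ProperPart P => bjornerMap 𝕜 α.1 0) ∧
      ∀ n,
        DirectSum.lmap (fun α : ProperPart P => bjornerMap 𝕜 α.1 n) ∘ₗ
            seqDifferential 𝕜 Delta n (fun _ _ h => phiDelta 𝕜 h n) =
          seqDifferential 𝕜 Gamma n (fun _ _ h => phiGamma 𝕜 hS h n) ∘ₗ
            DirectSum.lmap (fun α : ProperPart P => bjornerMap 𝕜 α.1 (n + 1))) := by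
  refine ⟨fun α β h i _ => ⟨bjornerMap_bijective 𝕜 hS α (i + 1), bjornerMap_bijective 𝕜 hS β i,
    bjornerMap_comp_phiDelta 𝕜 hS h i⟩, bjornerMapEmpty_bijective 𝕜 hS 0, fun n => ⟨?_, ?_⟩,
    bjornerMapEmpty_comp_seqAugmentation 𝕜, fun n => ?_⟩
  · exact (DirectSum.lmap_injective _).mpr fun α => (bjornerMap_bijective 𝕜 hS α.1 n).1
  · exact (DirectSum.lmap_surjective _).mpr fun α => (bjornerMap_bijective 𝕜 hS α.1 n).2
  · exact lmap_comp_seqDifferential 𝕜 (f := fun a m => bjornerMap 𝕜 a m)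
      fun _ _ hl => bjornerMap_comp_phiDelta 𝕜 hS hl n
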